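/- Let $n\ge 1$ be an integer, $t,s\in\mathbb{R}$ and $p\in[1,2]$. Use the unitary Fourier transform $\hat f(\xi)=\mathcal{F}f(\xi)=(2\pi)^{-n/2}\int_{\mathbb{R}^n}e^{-ix\cdot\xi}f(x)\,dx$, extended to the tempered distributions $\mathcal{S}'(\mathbb{R}^n)$, and write $\langle\xi\rangle=\sqrt{1+|\xi|^2}$. Let $H^s(\mathbb{R}^n)=\{u\in\mathcal{S}'(\mathbb{R}^n):\mathcal{F}^{-1}(\langle\cdot\rangle^s\hat u)\in L^2(\mathbb{R}^n)\}$ with norm $\|u\|_{H^s}=\|\langle\cdot\rangle^s\hat u\|_2$, and for $u\in\mathcal{S}'(\mathbb{R}^n)$ let $\|u\|_{H^{t,p}}=\|\mathcal{F}^{-1}(\langle\cdot\rangle^t\hat u)\|_p$, understood as $\infty$ if $\mathcal{F}^{-1}(\langle\cdot\rangle^t\hat u)\notin L^p(\mathbb{R}^n)$. Let $\mathcal{F}^s(\mathbb{R}^n)$ be the group, under composition, of all additive (not necessarily linear) bijections $P:H^s(\mathbb{R}^n)\to H^s(\mathbb{R}^n)$ such that $|\widehat{Pf}|=|\hat f|$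 almost everywhere for every $f\in H^s(\mathbb{R}^n)$, and let $G$ be a subgroup of $\mathcal{F}^s(\mathbb{R}^n)$. For $f,g\in H^s(\mathbb{R}^n)$ put $$d([f],[g])=\inf_{P\in G}\|f-Pg\|_{H^s},\qquad A_{f\cap g}=\operatorname{supp}(\hat f)\cap\operatorname{supp}(\hat g),$$ where the supports are those of distributions, and let $c_{n,p}=\|\mathcal{F}\|^2_{L^p(\mathbb{R}^n)\to L^{p/(p-1)}(\mathbb{R}^n)}$; here $\frac{1}{1-1}=\frac{2}{2-2}=\infty$ and $0\cdot\infty=0$. Then $c_{n,p}\le 1$, and for all $f,g\in H^s(\mathbb{R}^n)$ $$d([f],[g])^2\le\big\|\langle\xi\rangle^s(|\hat f|-|\hat g|)\big\|_2^2+c_{n,p}\,\big\|\chi_{A_{f\cap g}}\langle\xi\rangle^{2s-2t}\big\|_{\frac{p}{2-p}}\,\inf_{P,Q\in G}\|Pf-Qg\|_{H^{t,p}}^2 .$$ Moreover, the constant $\|\chi_{A_{f\cap g}}\langle\xi\rangle^{2s-2t}\|_{\frac{p}{2-p}}$ is finite if one of the following conditions holds: (i) $A_{f\cap g}$ is compact;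 (ii) $A_{f\cap g}$ has finite measure and $s\le t$; (iii) $s<t-n\left(\frac1p-\frac12\right)$. -/

import Mathlib

open MeasureTheory FourierTransform Distribution
open scoped ENNReal SchwartzMap

noncomputable section

namespace FourierPhase

/-- The Euclidean space `ℝⁿ` with its Euclidean norm and Lebesgue measure. -/
abbrev Rn (n : ℕ) : Type := EuclideanSpace ℝ (Fin n)

/-- The Japanese bracket `⟨ξ⟩ = √(1 + |ξ|²)`. -/
def bracket {n : ℕ} (ξ : Rn n) : ℝ := Real.sqrt (1 + ‖ξ‖ ^ 2)

theorem bracket_rpow {n : ℕ} (t : ℝ) (ξ : Rn n) :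
    bracket ξ ^ t = (1 + ‖ξ‖ ^ 2) ^ (t / 2) := by
  rw [bracket, Real.sqrt_eq_rpow, ← Real.rpow_mul (by positivity)]
  congr 1
  ring

/-- Powers of `⟨ξ⟩` may multiply tempered distributions. -/
theorem hasTemperateGrowth_bracket_rpow (n : ℕ) (t : ℝ) :
    (fun ξ : Rn n => ((bracket ξ ^ t : ℝ) : ℂ)).HasTemperateGrowth := by
  simp only [bracket_rpow]
  fun_prop

/-- The dilation `x ↦ (2π)⁻¹ x` of `ℝⁿ`. -/
def dilation (n : ℕ) : Rn n ≃L[ℝ] Rn n :=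
  ContinuousLinearEquiv.smulLeft (Units.mk0 (2 * Real.pi)⁻¹ (by positivity))

/-- The normalizing factor `(2π)^{-n/2}`. -/
def normFactor (n : ℕ) : ℂ := (((2 * Real.pi) ^ (-(n : ℝ) / 2) : ℝ) : ℂ)

/-- The unitary Fourier transform `φ̂(ξ) = (2π)^{-n/2} ∫ e^{-i x·ξ} φ(x) dx` of Schwartz functions;
see `schwartzFourier_apply`. -/
def schwartzFourier (n : ℕ) : 𝓢(Rn n, ℂ) →L[ℂ] 𝓢(Rn n, ℂ) :=
  normFactor n • (SchwartzMap.compCLMOfContinuousLinearEquiv ℂ (dilation n) ∘L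
    fourierCLM ℂ 𝓢(Rn n, ℂ))

/-- The inverse transform `φ ↦ (2π)^{-n/2} ∫ e^{i x·ξ} φ(ξ) dξ` of Schwartz functions;
see `schwartzFourierInv_apply`. -/
def schwartzFourierInv (n : ℕ) : 𝓢(Rn n, ℂ) →L[ℂ] 𝓢(Rn n, ℂ) :=
  normFactor n • (SchwartzMap.compCLMOfContinuousLinearEquiv ℂ (dilation n) ∘L
    fourierInvCLM ℂ 𝓢(Rn n, ℂ))

theorem schwartzFourier_apply {n : ℕ} (φ : 𝓢(Rn n, ℂ)) (ξ : Rn n) :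
    schwartzFourier n φ ξ =
      normFactor n * ∫ x, Complex.exp (-(Complex.I * (inner ℝ x ξ : ℝ))) * φ x := by
  have h : schwartzFourier n φ ξ = normFactor n * (𝓕 (φ : Rn n → ℂ)) ((2 * Real.pi)⁻¹ • ξ) := rfl
  rw [h, Real.fourier_eq']
  congr 2
  ext x
  rw [smul_eq_mul, inner_smul_right]
  congr 2
  push_cast
  have : (Real.pi : ℂ) ≠ 0 := by exact_mod_cast Real.pi_ne_zero
  field_simp

theorem schwartzFourierInv_apply {n : ℕ} (φ : 𝓢(Rn n, ℂ)) (x : Rn n) :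
    schwartzFourierInv n φ x =
      normFactor n * ∫ ξ, Complex.exp (Complex.I * (inner ℝ ξ x : ℝ)) * φ ξ := by
  have h : schwartzFourierInv n φ x =
      normFactor n * (𝓕⁻ φ : 𝓢(Rn n, ℂ)) ((2 * Real.pi)⁻¹ • x) := rfl
  rw [h, SchwartzMap.fourierInv_coe, Real.fourierInv_eq']
  congr 2
  ext ξ
  rw [smul_eq_mul, inner_smul_right]
  congr 2
  push_cast
  have : (Real.pi : ℂ) ≠ 0 := by exact_mod_cast Real.pi_ne_zero
  field_simp

/-- The Fourier transform of tempered distributions, `û(φ) = u(φ̂)`. -/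
def fourier (n : ℕ) : 𝓢'(Rn n, ℂ) →L[ℂ] 𝓢'(Rn n, ℂ) :=
  PointwiseConvergenceCLM.precomp ℂ (schwartzFourier n)

/-- The inverse Fourier transform of tempered distributions. -/
def fourierInv (n : ℕ) : 𝓢'(Rn n, ℂ) →L[ℂ] 𝓢'(Rn n, ℂ) :=
  PointwiseConvergenceCLM.precomp ℂ (schwartzFourierInv n)

/-- The product `⟨·⟩^t u` with a tempered distribution `u`. -/
def bracketMul (n : ℕ) (t : ℝ) : 𝓢'(Rn n, ℂ) →L[ℂ] 𝓢'(Rn n, ℂ) :=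
  TemperedDistribution.smulLeftCLM ℂ (fun ξ : Rn n => ((bracket ξ ^ t : ℝ) : ℂ))

/-- The tempered distribution `u` is given by integration against the function `v`. -/
def IsRepresentedBy {n : ℕ} (u : 𝓢'(Rn n, ℂ)) (v : Rn n → ℂ) : Prop :=
  LocallyIntegrable v volume ∧
    ∀ φ : 𝓢(Rn n, ℂ), Integrable (fun x => φ x * v x) volume ∧ u φ = ∫ x, φ x * v x

/-- The tempered distribution `u` belongs to `L^q(ℝⁿ)`. -/
def IsLp {n : ℕ} (q : ℝ≥0∞) (u : 𝓢'(Rn n, ℂ)) : Prop :=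
  ∃ v : Rn n → ℂ, IsRepresentedBy u v ∧ MemLp v q volume

/-- The `L^q` norm of a tempered distribution: the `L^q` norm of the (a.e. unique) function that
represents it, and `∞` if there is none. -/
def lpNorm {n : ℕ} (q : ℝ≥0∞) (u : 𝓢'(Rn n, ℂ)) : ℝ≥0∞ :=
  ⨅ (v : Rn n → ℂ) (_ : IsRepresentedBy u v), eLpNorm v q volume

/-- The Bessel potential norm `‖u‖_{H^{t,p}} = ‖𝓕⁻¹(⟨·⟩^t û)‖_p`, equal to `∞` if `u ∉ H^{t,p}`. -/
def besselNorm {n : ℕ} (t : ℝ) (p : ℝ≥0∞) (u : 𝓢'(Rn n, ℂ)) : ℝ≥0∞ :=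
  lpNorm p (fourierInv n (bracketMul n t (fourier n u)))

/-- The norm `‖u‖_{H^s} = ‖⟨·⟩^s û‖_2`. -/
def sobolevNorm {n : ℕ} (s : ℝ) (u : 𝓢'(Rn n, ℂ)) : ℝ≥0∞ :=
  lpNorm 2 (bracketMul n s (fourier n u))

theorem IsRepresentedBy.add {n : ℕ} {u₁ u₂ : 𝓢'(Rn n, ℂ)} {v₁ v₂ : Rn n → ℂ}
    (h₁ : IsRepresentedBy u₁ v₁) (h₂ : IsRepresentedBy u₂ v₂) :
    IsRepresentedBy (u₁ + u₂) (v₁ + v₂) := by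
  refine ⟨h₁.1.add h₂.1, fun φ => ?_⟩
  have e : (fun x => φ x * (v₁ + v₂) x) = fun x => φ x * v₁ x + φ x * v₂ x := by
    ext x
    simp [mul_add]
  rw [e]
  refine ⟨(h₁.2 φ).1.add (h₂.2 φ).1, ?_⟩
  rw [integral_add (h₁.2 φ).1 (h₂.2 φ).1, ← (h₁.2 φ).2, ← (h₂.2 φ).2]
  rfl

theorem IsRepresentedBy.smul {n : ℕ} (c : ℂ) {u : 𝓢'(Rn n, ℂ)} {v : Rn n → ℂ}
    (h : IsRepresentedBy u v) : IsRepresentedBy (c • u) (c • v) := by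
  refine ⟨h.1.smul c, fun φ => ?_⟩
  have e : (fun x => φ x * (c • v) x) = fun x => c * (φ x * v x) := by
    ext x
    simp only [Pi.smul_apply, smul_eq_mul]
    ring
  rw [e]
  refine ⟨(h.2 φ).1.const_mul c, ?_⟩
  rw [integral_const_mul, ← (h.2 φ).2]
  rfl

theorem isRepresentedBy_zero (n : ℕ) : IsRepresentedBy (0 : 𝓢'(Rn n, ℂ)) 0 := by
  refine ⟨locallyIntegrable_zero, fun φ => ?_⟩
  simp

/-- The Sobolev space `H^s(ℝⁿ) = {u ∈ 𝓢'(ℝⁿ) : 𝓕⁻¹(⟨·⟩^s û) ∈ L²(ℝⁿ)}`. -/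
def Hs (n : ℕ) (s : ℝ) : Submodule ℂ 𝓢'(Rn n, ℂ) where
  carrier := {u | IsLp 2 (fourierInv n (bracketMul n s (fourier n u)))}
  add_mem' := by
    rintro a b ⟨v, hv, hv'⟩ ⟨w, hw, hw'⟩
    refine ⟨v + w, ?_, hv'.add hw'⟩
    simpa only [map_add] using hv.add hw
  zero_mem' := by
    refine ⟨0, ?_, MemLp.zero⟩
    simpa only [map_zero] using isRepresentedBy_zero n
  smul_mem' := by
    rintro c a ⟨v, hv, hv'⟩
    refine ⟨c • v, ?_, hv'.const_smul c⟩
    simpa only [map_smul] using hv.smul c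

open Classical in
/-- The Fourier transform `û` as a function, determined up to a null set, for a tempered
distribution `u` whose Fourier transform is a function, in particular for every `u ∈ H^s(ℝⁿ)`
(the value `0` in the remaining cases is never used). -/
def hat {n : ℕ} (u : 𝓢'(Rn n, ℂ)) : Rn n → ℂ :=
  if h : ∃ v : Rn n → ℂ, IsRepresentedBy (fourier n u) v then h.choose else 0

/-- The group (under composition) of the additive bijections `P` of `H^s(ℝⁿ)` with
`|(Pf)^| = |f̂|` almost everywhere for every `f ∈ H^s(ℝⁿ)`. -/
def phaseGroup (n : ℕ) (s : ℝ) : Subgroup (Equiv.Perm (Hs n s)) where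
  carrier := {P | (∀ f g : Hs n s, P (f + g) = P f + P g) ∧
    ∀ f : Hs n s, ∀ᵐ ξ : Rn n, ‖hat (f : 𝓢'(Rn n, ℂ)) ξ‖ = ‖hat (P f : 𝓢'(Rn n, ℂ)) ξ‖}
  mul_mem' := by
    rintro P Q ⟨hP, hP'⟩ ⟨hQ, hQ'⟩
    refine ⟨fun f g => by simp [hP, hQ], fun f => ?_⟩
    filter_upwards [hQ' f, hP' (Q f)] with ξ h₁ h₂
    rw [h₁, h₂]
    rfl
  one_mem' := ⟨fun _ _ => rfl, fun _ => Filter.Eventually.of_forall fun _ => rfl⟩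
  inv_mem' := by
    rintro P ⟨hP, hP'⟩
    refine ⟨fun f g => ?_, fun f => ?_⟩
    · apply P.injective
      simp [hP]
    · filter_upwards [hP' (P⁻¹ f)] with ξ h
      rw [h]
      simp

/-- The quotient distance `d([f],[g]) = inf_{P ∈ G} ‖f - P g‖_{H^s}`. -/
def quotDist {n : ℕ} {s : ℝ} (G : Subgroup (Equiv.Perm (Hs n s))) (f g : Hs n s) : ℝ≥0∞ :=
  ⨅ P ∈ G, sobolevNorm s ((f - P g : Hs n s) : 𝓢'(Rn n, ℂ))

/-- `supp f̂ ∩ supp ĝ`, with supports in the sense of distributions. -/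
def suppInter {n : ℕ} (f g : 𝓢'(Rn n, ℂ)) : Set (Rn n) :=
  dsupport (fourier n f) ∩ dsupport (fourier n g)

/-- The weight constant `‖χ_A ⟨ξ⟩^{2s-2t}‖_{p/(2-p)}`. In `ℝ≥0∞` one has `2 / (2 - 2) = ∞`. -/
def weightConst {n : ℕ} (A : Set (Rn n)) (s t : ℝ) (p : ℝ≥0∞) : ℝ≥0∞ :=
  eLpNorm (A.indicator fun ξ => bracket ξ ^ (2 * s - 2 * t)) (p / (2 - p)) volume

/-- `c_{n,p}`, the square of the operator norm of the Fourier transform from `L^p(ℝⁿ)` to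
`L^{p/(p-1)}(ℝⁿ)`. In `ℝ≥0∞` one has `1 / (1 - 1) = ∞`. -/
def fourierConst (n : ℕ) (p : ℝ≥0∞) : ℝ≥0∞ :=
  (sInf {C : ℝ≥0∞ | ∀ u : 𝓢'(Rn n, ℂ), IsLp p u →
    lpNorm (p / (p - 1)) (fourier n u) ≤ C * lpNorm p u}) ^ 2

end FourierPhase

end

open FourierPhase

namespace FourierPhase

variable {n : ℕ}

/-! Elements of `G` are additive and preserve the modulus of the Fourier transform, hence the `H^s`
norm, so `d([f],[g]) ≤ ‖Pf - Qg‖_{H^s}` for all `P, Q ∈ G` (`quotDist_le_eLpNorm`). Let `a`, `b` be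
the Fourier transforms of `Pf`, `Qg`; their moduli are `|f̂|`, `|ĝ|`. Off `A_{f∩g}` one of `a`, `b`
vanishes, so `|a - b| = ||f̂| - |ĝ||`: phases do not matter there. On `A_{f∩g}`, write `⟨ξ⟩^{2s} =
⟨ξ⟩^{2s-2t} ⟨ξ⟩^{2t}` and apply Hölder with exponents `p/(2-p)` and `p'/2`, where `p' = p/(p-1)`
(`lintegral_sq_bracket_mul_le`). The factor `‖⟨·⟩^t (a - b)‖_{p'}^2` is controlled by
Hausdorff–Young (`Hs.eLpNorm_bracketHat_sq_le`).

Hausdorff–Young with constant 1, which is also the bound `c_{n,p} ≤ 1`, comes from the three lines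
theorem for the bilinear pairing of simple functions, then duality, then density.

The infimum over `P, Q` is delicate only when the weight constant is infinite. If the infimum is
positive the right-hand side is infinite, because `c_{n,p} ≠ 0`. If it is zero the product is `∞ · 0
= 0`, and `d([f],[g]) = 0` has to be proved by dominated convergence
(`quotDist_eq_zero_of_tendsto`). -/

/-! ### Functions representing tempered distributions -/

/-- A function representing `u` vanishes almost everywhere on open sets on which `u` vanishes. -/
theorem IsRepresentedBy.ae_eq_zero_of_isVanishingOn {u : 𝓢'(Rn n, ℂ)} {v : Rn n → ℂ}
    (h : IsRepresentedBy u v) {U : Set (Rn n)} (hU : IsOpen U) (hu : IsVanishingOn u U) :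
    ∀ᵐ x : Rn n, x ∈ U → v x = 0 := by
  refine hU.ae_eq_zero_of_integral_contDiff_smul_eq_zero (h.1.locallyIntegrableOn U) ?_
  intro g hg hgc hgU
  have hgc' : HasCompactSupport (fun x => (g x : ℂ)) := hgc.comp_left (g := Complex.ofReal) rfl
  have hg' : ContDiff ℝ (↑(⊤ : ℕ∞)) (fun x => (g x : ℂ)) := Complex.ofRealCLM.contDiff.comp hg
  have key := (h.2 (hgc'.toSchwartzMap hg')).2
  have hz : u (hgc'.toSchwartzMap hg') = 0 := by
    apply hu
    refine (closure_mono ?_).trans hgU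
    intro x hx
    simpa using hx
  rw [hz] at key
  simpa using key.symm

/-- The function representing a tempered distribution is unique up to null sets. -/
theorem IsRepresentedBy.ae_eq {u : 𝓢'(Rn n, ℂ)} {v w : Rn n → ℂ}
    (hv : IsRepresentedBy u v) (hw : IsRepresentedBy u w) : v =ᵐ[volume] w := by
  have h : IsRepresentedBy (u + (-1 : ℂ) • u) (v + (-1 : ℂ) • w) := hv.add (hw.smul (-1))
  have h0 : u + (-1 : ℂ) • u = 0 := by
    ext φ
    change u φ + (-1 : ℂ) * u φ = 0
    ring
  rw [h0] at h
  filter_upwards [h.ae_eq_zero_of_isVanishingOn isOpen_univ (fun φ _ => rfl)] with x hx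
  have := hx (Set.mem_univ x)
  simp only [Pi.add_apply, Pi.smul_apply, smul_eq_mul] at this
  linear_combination this

theorem IsRepresentedBy.aestronglyMeasurable {u : 𝓢'(Rn n, ℂ)} {v : Rn n → ℂ}
    (hv : IsRepresentedBy u v) : AEStronglyMeasurable v volume :=
  hv.1.aestronglyMeasurable

/-- By uniqueness the infimum runs over a single a.e. class. -/
theorem IsRepresentedBy.lpNorm_eq {u : 𝓢'(Rn n, ℂ)} {v : Rn n → ℂ}
    (hv : IsRepresentedBy u v) (q : ℝ≥0∞) : lpNorm q u = eLpNorm v q volume := by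
  refine le_antisymm (iInf₂_le v hv) (le_iInf₂ fun w hw => ?_)
  rw [eLpNorm_congr_ae (hv.ae_eq hw)]

theorem isLp_of_lpNorm_ne_top {u : 𝓢'(Rn n, ℂ)} {q : ℝ≥0∞} (h : lpNorm q u ≠ ∞) : IsLp q u := by
  have h' := h.lt_top
  simp only [lpNorm, iInf_lt_iff] at h'
  obtain ⟨v, hv, hlt⟩ := h'
  exact ⟨v, hv, hv.aestronglyMeasurable, hlt⟩

theorem IsLp.lpNorm_ne_top {u : 𝓢'(Rn n, ℂ)} {q : ℝ≥0∞} (h : IsLp q u) : lpNorm q u ≠ ∞ := by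
  obtain ⟨v, hv, hm⟩ := h
  rw [hv.lpNorm_eq]
  exact hm.2.ne

/-- A function representing `u` vanishes almost everywhere off the support of `u`. -/
theorem IsRepresentedBy.ae_eq_zero_of_notMem_dsupport {u : 𝓢'(Rn n, ℂ)} {v : Rn n → ℂ}
    (h : IsRepresentedBy u v) : ∀ᵐ x : Rn n, x ∉ dsupport u → v x = 0 := by
  -- The complement of the support may be an uncountable union of vanishing sets, so nullity is
  -- checked locally.
  have : volume {x | ¬ (x ∉ dsupport u → v x = 0)} = 0 := by
    refine measure_null_of_locally_null _ fun x hx => ?_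
    simp only [Set.mem_ofPred_eq, Classical.not_imp] at hx
    obtain ⟨U, hU, hUo, hxU⟩ := (notMem_dsupport_iff x).1 hx.1
    refine ⟨U ∩ {x | ¬ (x ∉ dsupport u → v x = 0)}, ?_, ?_⟩
    · exact Filter.inter_mem (mem_nhdsWithin_of_mem_nhds (hUo.mem_nhds hxU)) self_mem_nhdsWithin
    · refine measure_mono_null ?_ (h.ae_eq_zero_of_isVanishingOn hUo hU)
      rintro y ⟨hy, hy'⟩
      simp only [Set.mem_ofPred_eq, Classical.not_imp] at hy'
      intro hc
      exact hy'.2 (hc hy)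
  exact this

theorem isClosed_dsupport (u : 𝓢'(Rn n, ℂ)) : IsClosed (dsupport u) :=
  isClosed_sInter fun _ hs => hs.2

/-! ### The bracket weight and Fourier inversion -/

theorem one_le_bracket (ξ : Rn n) : 1 ≤ bracket ξ := by
  rw [bracket, Real.one_le_sqrt]
  nlinarith [sq_nonneg ‖ξ‖]

theorem bracket_pos (ξ : Rn n) : 0 < bracket ξ := one_pos.trans_le (one_le_bracket ξ)

theorem continuous_bracket_rpow (t : ℝ) : Continuous fun ξ : Rn n => bracket ξ ^ t := by
  refine Continuous.rpow_const ?_ fun ξ => Or.inl (bracket_pos ξ).ne'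
  unfold bracket
  fun_prop

theorem IsRepresentedBy.bracketMul {u : 𝓢'(Rn n, ℂ)} {v : Rn n → ℂ} (h : IsRepresentedBy u v)
    (t : ℝ) :
    IsRepresentedBy (bracketMul n t u) (fun ξ => ((bracket ξ ^ t : ℝ) : ℂ) * v ξ) := by
  refine ⟨?_, fun φ => ?_⟩
  · have := h.1.smul_continuous (Complex.continuous_ofReal.comp (continuous_bracket_rpow t))
    refine this.congr (Filter.Eventually.of_forall fun x => ?_)
    simp [mul_comm]
  · have key := h.2 (SchwartzMap.smulLeftCLM ℂ (fun ξ : Rn n => ((bracket ξ ^ t : ℝ) : ℂ)) φ)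
    have e : (fun x => SchwartzMap.smulLeftCLM ℂ (fun ξ : Rn n => ((bracket ξ ^ t : ℝ) : ℂ)) φ x
        * v x) = fun x => φ x * (((bracket x ^ t : ℝ) : ℂ) * v x) := by
      ext x
      rw [SchwartzMap.smulLeftCLM_apply_apply (hasTemperateGrowth_bracket_rpow n t), smul_eq_mul]
      ring
    rw [e] at key
    refine ⟨key.1, ?_⟩
    rw [← key.2]
    exact TemperedDistribution.smulLeftCLM_apply_apply _ _ _

theorem bracketMul_bracketMul (s t : ℝ) (u : 𝓢'(Rn n, ℂ)) :
    FourierPhase.bracketMul n s (FourierPhase.bracketMul n t u)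
      = FourierPhase.bracketMul n (s + t) u := by
  unfold FourierPhase.bracketMul
  rw [TemperedDistribution.smulLeftCLM_smulLeftCLM_apply (hasTemperateGrowth_bracket_rpow n t)
    (hasTemperateGrowth_bracket_rpow n s)]
  congr 2
  ext ξ
  simp [Real.rpow_add (bracket_pos ξ), mul_comm]

theorem bracketMul_zero (u : 𝓢'(Rn n, ℂ)) : FourierPhase.bracketMul n 0 u = u := by
  unfold FourierPhase.bracketMul
  simp [TemperedDistribution.smulLeftCLM_const]

/-- `L^q` functions represent tempered distributions. -/
theorem isRepresentedBy_toTemperedDistribution {q : ℝ≥0∞} [hq : Fact (1 ≤ q)]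
    (v : Lp ℂ q (volume : Measure (Rn n))) :
    IsRepresentedBy (Lp.toTemperedDistribution v) v := by
  refine ⟨(Lp.memLp v).locallyIntegrable hq.out, fun φ => ⟨?_, ?_⟩⟩
  · have : ENNReal.HolderConjugate q (ENNReal.conjExponent q) :=
      ENNReal.HolderConjugate.conjExponent hq.out
    have := this.symm
    exact (φ.memLp (ENNReal.conjExponent q)).integrable_mul (Lp.memLp v)
  · simp [Lp.toTemperedDistribution_apply]

/-- The two normalizing factors cancel the Jacobian of the dilation by `(2π)⁻¹`. -/
theorem normFactor_sq_mul_pow : normFactor n * normFactor n * ((2 * Real.pi : ℝ) : ℂ) ^ n = 1 := by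
  unfold normFactor
  rw [← Complex.ofReal_pow, ← Complex.ofReal_mul, ← Complex.ofReal_mul, ← Complex.ofReal_one,
    Complex.ofReal_inj, ← Real.rpow_natCast, ← Real.rpow_add (by positivity), ← Real.rpow_add (by positivity)]
  rw [show -(n : ℝ) / 2 + -n / 2 + n = 0 by ring, Real.rpow_zero]

theorem schwartzFourierInv_schwartzFourier (φ : 𝓢(Rn n, ℂ)) :
    schwartzFourierInv n (schwartzFourier n φ) = φ := by
  ext x
  have h1 : ∀ ξ, schwartzFourier n φ ξ = normFactor n * (𝓕 φ) ((2 * Real.pi)⁻¹ • ξ) :=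
    fun ξ => rfl
  have h2 : φ x = ∫ ξ, Complex.exp (↑(2 * Real.pi * inner ℝ ξ x) * Complex.I) * (𝓕 φ) ξ := by
    conv_lhs => rw [← fourierInv_fourier_eq (F := 𝓢(Rn n, ℂ)) φ]
    rw [SchwartzMap.fourierInv_coe, Real.fourierInv_eq']
    rfl
  rw [schwartzFourierInv_apply]
  simp only [h1]
  have h3 := Measure.integral_comp_smul (volume : Measure (Rn n))
    (fun ξ => Complex.exp (↑(2 * Real.pi * inner ℝ ξ x) * Complex.I) * (𝓕 φ) ξ) (2 * Real.pi)⁻¹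
  have h4 : ∀ ξ : Rn n, Complex.exp (Complex.I * (inner ℝ ξ x : ℝ)) *
      (normFactor n * (𝓕 φ) ((2 * Real.pi)⁻¹ • ξ)) = normFactor n *
      (Complex.exp (↑(2 * Real.pi * inner ℝ ((2 * Real.pi)⁻¹ • ξ) x) * Complex.I) *
        (𝓕 φ) ((2 * Real.pi)⁻¹ • ξ)) := by
    intro ξ
    rw [real_inner_smul_left, mul_inv_cancel_left₀ (by positivity), mul_comm Complex.I]
    ring
  simp_rw [h4]
  rw [integral_const_mul, h3, ← h2, finrank_euclideanSpace, Fintype.card_fin, inv_pow, inv_inv,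
    abs_of_pos (by positivity), Complex.real_smul, ← mul_assoc, ← mul_assoc]
  push_cast
  have := normFactor_sq_mul_pow (n := n)
  push_cast at this
  rw [this, one_mul]

theorem fourier_fourierInv (u : 𝓢'(Rn n, ℂ)) : fourier n (fourierInv n u) = u := by
  ext φ
  change u (schwartzFourierInv n (schwartzFourier n φ)) = u φ
  rw [schwartzFourierInv_schwartzFourier]


/-! ### The unitary Fourier transform of integrable functions -/

/-- The bilinear form `(x, ξ) ↦ (2π)⁻¹ x·ξ`. -/
noncomputable def scaledInner (n : ℕ) : Rn n →ₗ[ℝ] Rn n →ₗ[ℝ] ℝ :=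
  (2 * Real.pi)⁻¹ • innerₗ (Rn n)

theorem scaledInner_apply (x ξ : Rn n) :
    scaledInner n x ξ = inner ℝ x ((2 * Real.pi)⁻¹ • ξ) := by
  simp [scaledInner, inner_smul_right]

theorem scaledInner_flip : (scaledInner n).flip = scaledInner n := by
  ext x ξ
  simp [scaledInner, real_inner_comm]

theorem continuous_scaledInner :
    Continuous fun z : Rn n × Rn n => scaledInner n z.1 z.2 := by
  simp only [scaledInner_apply]
  fun_prop

/-- The unitary Fourier transform of an integrable function. -/
noncomputable def unitaryFourier (f : Rn n → ℂ) (ξ : Rn n) : ℂ :=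
  normFactor n * VectorFourier.fourierIntegral Real.fourierChar volume (scaledInner n) f ξ

theorem unitaryFourier_eq (f : Rn n → ℂ) (ξ : Rn n) :
    unitaryFourier f ξ = normFactor n * 𝓕 f ((2 * Real.pi)⁻¹ • ξ) := by
  rw [unitaryFourier, Real.fourier_eq, VectorFourier.fourierIntegral]
  simp only [scaledInner_apply]

theorem schwartzFourier_eq_unitaryFourier (φ : 𝓢(Rn n, ℂ)) :
    ⇑(schwartzFourier n φ) = unitaryFourier φ := by
  ext ξ
  rw [unitaryFourier_eq]
  rfl

/-- This crude bound suffices: only the constant 1 is needed at the `L¹ → L^∞` endpoint. -/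
theorem norm_normFactor_le_one : ‖normFactor n‖ ≤ 1 := by
  rw [normFactor, Complex.norm_real, Real.norm_of_nonneg (by positivity)]
  refine Real.rpow_le_one_of_one_le_of_nonpos (by linarith [Real.pi_gt_three]) ?_
  have : (0 : ℝ) ≤ n := n.cast_nonneg
  linarith

theorem norm_unitaryFourier_le (f : Rn n → ℂ) (ξ : Rn n) :
    ‖unitaryFourier f ξ‖ ≤ ∫ x, ‖f x‖ := by
  rw [unitaryFourier, norm_mul]
  have h := VectorFourier.norm_fourierIntegral_le_integral_norm Real.fourierChar volume
    (scaledInner n) f ξ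
  calc _ ≤ 1 * ∫ x, ‖f x‖ := mul_le_mul norm_normFactor_le_one h (norm_nonneg _) zero_le_one
    _ = _ := one_mul _

theorem continuous_unitaryFourier {f : Rn n → ℂ} (hf : Integrable f) :
    Continuous (unitaryFourier f) :=
  continuous_const.mul
    (VectorFourier.fourierIntegral_continuous Real.continuous_fourierChar continuous_scaledInner hf)

theorem unitaryFourier_add {f g : Rn n → ℂ} (hf : Integrable f) (hg : Integrable g) :
    unitaryFourier (f + g) = unitaryFourier f + unitaryFourier g := by
  ext ξ
  simp only [unitaryFourier, Pi.add_apply, VectorFourier.fourierIntegral_add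
    Real.continuous_fourierChar continuous_scaledInner hf hg, mul_add]

theorem unitaryFourier_const_smul (c : ℂ) (f : Rn n → ℂ) :
    unitaryFourier (c • f) = c • unitaryFourier f := by
  ext ξ
  simp only [unitaryFourier, Pi.smul_apply, VectorFourier.fourierIntegral_const_smul, smul_eq_mul]
  ring

theorem unitaryFourier_sub {f g : Rn n → ℂ} (hf : Integrable f) (hg : Integrable g) :
    unitaryFourier (f - g) = unitaryFourier f - unitaryFourier g := by
  have h := unitaryFourier_add hf (hg.smul (-1 : ℂ))
  rw [unitaryFourier_const_smul] at h
  simpa [sub_eq_add_neg] using h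

theorem unitaryFourier_sum {ι : Type*} (s : Finset ι) {f : ι → Rn n → ℂ}
    (hf : ∀ i ∈ s, Integrable (f i)) :
    unitaryFourier (∑ i ∈ s, f i) = ∑ i ∈ s, unitaryFourier (f i) := by
  classical
  induction s using Finset.induction_on with
  | empty =>
    have := unitaryFourier_const_smul (n := n) 0 0
    simpa using this
  | insert i s hi ih =>
    rw [Finset.sum_insert hi, Finset.sum_insert hi, unitaryFourier_add
      (hf i (Finset.mem_insert_self i s))
      (integrable_finsetSum' s fun j hj => hf j (Finset.mem_insert_of_mem hj)),
      ih fun j hj => hf j (Finset.mem_insert_of_mem hj)]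

/-- The multiplication formula links the integral transform to the transform of distributions, which
is defined by duality. -/
theorem integral_unitaryFourier_mul_eq {f g : Rn n → ℂ} (hf : Integrable f) (hg : Integrable g) :
    ∫ ξ, unitaryFourier f ξ * g ξ = ∫ x, f x * unitaryFourier g x := by
  have h := VectorFourier.integral_fourierIntegral_smul_eq_flip (L := scaledInner n)
    Real.continuous_fourierChar continuous_scaledInner hf hg
  rw [scaledInner_flip] at h
  simp only [unitaryFourier, smul_eq_mul] at h ⊢
  simp_rw [mul_assoc, mul_left_comm _ (normFactor n)]
  rw [integral_const_mul, integral_const_mul, h]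

theorem integrable_unitaryFourier_mul {f g : Rn n → ℂ} (hf : Integrable f) (hg : Integrable g) :
    Integrable fun ξ => unitaryFourier f ξ * g ξ :=
  hg.bdd_mul (c := ∫ x, ‖f x‖) (continuous_unitaryFourier hf).aestronglyMeasurable
    (Filter.Eventually.of_forall (norm_unitaryFourier_le f))

/-- In `L²` the dilation contributes `(2π)^{n/2}`, exactly the inverse of the normalizing factor. -/
theorem eLpNorm_two_comp_dilation {h : Rn n → ℂ} (hh : AEStronglyMeasurable h volume) :
    eLpNorm (fun ξ => normFactor n * h ((2 * Real.pi)⁻¹ • ξ)) 2 volume = eLpNorm h 2 volume := by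
  have h2 : (2 * Real.pi)⁻¹ ≠ 0 := by positivity
  have hmap := Measure.map_addHaar_smul (volume : Measure (Rn n)) h2
  have e1 : eLpNorm (fun ξ => h ((2 * Real.pi)⁻¹ • ξ)) 2 volume
      = eLpNorm h 2 (Measure.map (fun x : Rn n => (2 * Real.pi)⁻¹ • x) volume) := by
    rw [eLpNorm_map_measure _ (by fun_prop)]
    · rfl
    · rw [hmap]
      exact hh.smul_measure _
  change eLpNorm (normFactor n • fun ξ => h ((2 * Real.pi)⁻¹ • ξ)) 2 volume = _
  rw [eLpNorm_const_smul, e1, hmap, eLpNorm_smul_measure_of_ne_top (by simp), smul_eq_mul,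
    ← mul_assoc]
  convert one_mul _
  rw [finrank_euclideanSpace, Fintype.card_fin, inv_pow, inv_inv, abs_of_pos (by positivity),
    ENNReal.ofReal_rpow_of_pos (by positivity), normFactor, ← ofReal_norm,
    Complex.norm_real, Real.norm_of_nonneg (by positivity), ← ENNReal.ofReal_mul (by positivity),
    ← Real.rpow_natCast, ← Real.rpow_mul (by positivity), ← Real.rpow_add (by positivity)]
  have : -(n : ℝ) / 2 + n * (1 / (2 : ℝ≥0∞)).toReal = 0 := by
    simp
    ring
  rw [this]
  simp

/-- Plancherel's theorem on `L¹ ∩ L²`. -/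
theorem eLpNorm_two_unitaryFourier {f : Rn n → ℂ} (hf : Integrable f) (hf2 : MemLp f 2 volume) :
    eLpNorm (unitaryFourier f) 2 volume = eLpNorm f 2 volume := by
  have hc : Continuous (𝓕 f) := VectorFourier.fourierIntegral_continuous
    Real.continuous_fourierChar continuous_inner hf
  have e : unitaryFourier f = fun ξ => normFactor n * 𝓕 f ((2 * Real.pi)⁻¹ • ξ) :=
    funext (unitaryFourier_eq f)
  rw [e, eLpNorm_two_comp_dilation hc.aestronglyMeasurable]
  -- The Fourier integral and the `L²` transform define the same tempered distribution, hence agree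
  -- almost everywhere.
  have hrep : IsRepresentedBy (Lp.toTemperedDistribution (𝓕 (hf2.toLp f))) (𝓕 f) := by
    refine ⟨hc.locallyIntegrable, fun φ => ?_⟩
    have hb : Integrable fun x => 𝓕 f x * φ x := by
      refine φ.integrable.bdd_mul (c := ∫ x, ‖f x‖) hc.aestronglyMeasurable
        (Filter.Eventually.of_forall fun ξ => ?_)
      exact VectorFourier.norm_fourierIntegral_le_integral_norm _ _ _ _ _
    refine ⟨by simpa only [mul_comm] using hb, ?_⟩
    rw [← Lp.fourier_toTemperedDistribution_eq, TemperedDistribution.fourier_apply,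
      Lp.toTemperedDistribution_apply]
    have h := VectorFourier.integral_fourierIntegral_smul_eq_flip (L := innerₗ (Rn n))
      Real.continuous_fourierChar continuous_inner (φ.integrable (μ := volume)) hf
    rw [flip_innerₗ] at h
    refine Eq.trans (integral_congr_ae ?_) h
    filter_upwards [hf2.coeFn_toLp] with x hx
    rw [hx]
    rfl
  have h1 := hrep.ae_eq (isRepresentedBy_toTemperedDistribution (𝓕 (hf2.toLp f)))
  rw [eLpNorm_congr_ae h1, ← Lp.enorm_def, ← ofReal_norm, Lp.norm_fourier_eq,
    ofReal_norm, Lp.enorm_def, eLpNorm_congr_ae hf2.coeFn_toLp]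


/-! ### Interpolation between `L¹ → L^∞` and `L² → L²` -/

/-- The analytic family `y ↦ (y / |y|) |y|^{p (1 - z / 2)}`. -/
noncomputable def powFamily (p : ℝ) (z y : ℂ) : ℂ :=
  y / ‖y‖ * Complex.exp (p * (1 - z / 2) * Real.log ‖y‖)

theorem powFamily_zero (p : ℝ) (z : ℂ) : powFamily p z 0 = 0 := by simp [powFamily]

theorem differentiable_powFamily (p : ℝ) (y : ℂ) : Differentiable ℂ fun z => powFamily p z y := by
  unfold powFamily
  fun_prop

theorem norm_powFamily {p : ℝ} {z : ℂ} (h : 0 < p * (1 - z.re / 2)) (y : ℂ) :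
    ‖powFamily p z y‖ = ‖y‖ ^ (p * (1 - z.re / 2)) := by
  by_cases hy : y = 0
  · rw [hy, powFamily_zero, norm_zero, Real.zero_rpow h.ne']
  · have hy' : 0 < ‖y‖ := norm_pos_iff.2 hy
    rw [powFamily, norm_mul, norm_div, Complex.norm_real, norm_norm, div_self hy'.ne', one_mul,
      Complex.norm_exp, Real.rpow_def_of_pos hy']
    congr 1
    rw [Complex.re_mul_ofReal, Complex.re_ofReal_mul]
    simp only [Complex.sub_re, Complex.one_re]
    rw [show z / 2 = z / ((2 : ℝ) : ℂ) by norm_num, Complex.div_ofReal_re]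
    ring

/-- The bound does not depend on `z`, which gives the boundedness on the strip required by the three
lines theorem. -/
theorem norm_powFamily_le {p : ℝ} (hp : 0 ≤ p) {z : ℂ} (h0 : 0 ≤ z.re) (h1 : z.re ≤ 1) (y : ℂ) :
    ‖powFamily p z y‖ ≤ Real.exp (p * |Real.log ‖y‖|) := by
  rcases eq_or_lt_of_le hp with rfl | hp
  · simp only [powFamily, Complex.ofReal_zero, zero_mul, Complex.exp_zero, mul_one, norm_div,
      Complex.norm_real, norm_norm, Real.exp_zero]
    exact div_self_le_one _
  by_cases hy : y = 0
  · rw [hy, powFamily_zero, norm_zero]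
    positivity
  · have hy' : 0 < ‖y‖ := norm_pos_iff.2 hy
    rw [norm_powFamily (mul_pos hp (by linarith)), Real.rpow_def_of_pos hy', Real.exp_le_exp]
    calc Real.log ‖y‖ * (p * (1 - z.re / 2)) ≤ |Real.log ‖y‖| * (p * 1) := by
          apply mul_le_mul (le_abs_self _) _ _ (abs_nonneg _)
          · exact mul_le_mul_of_nonneg_left (by linarith) hp.le
          · exact mul_nonneg hp.le (by linarith)
      _ = _ := by ring

theorem powFamily_eq_self {p : ℝ} {z : ℂ} (h : (p : ℂ) * (1 - z / 2) = 1) (y : ℂ) :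
    powFamily p z y = y := by
  by_cases hy : y = 0
  · rw [hy, powFamily_zero]
  · have hy' : 0 < ‖y‖ := norm_pos_iff.2 hy
    rw [powFamily, h, one_mul, ← Complex.ofReal_exp, Real.exp_log hy']
    exact div_mul_cancel₀ _ (by exact_mod_cast hy'.ne')

/-- Splitting over level sets confines the dependence on `z` to finitely many coefficients, so the
interpolated pairing is entire. -/
theorem simpleFunc_comp_eq_sum (f : SimpleFunc (Rn n) ℂ) {h : ℂ → ℂ} :
    (fun x => h (f x)) = ∑ y ∈ f.range, h y • (f ⁻¹' {y}).indicator (1 : Rn n → ℂ) := by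
  ext x
  rw [Finset.sum_apply, Finset.sum_eq_single (f x)]
  · simp
  · intro y _ hy
    simp [hy.symm]
  · intro hx
    exact absurd (SimpleFunc.mem_range_self f x) hx

theorem integrable_smul_indicator_preimage {f : SimpleFunc (Rn n) ℂ} (hf : Integrable f)
    {h : ℂ → ℂ} (h0 : h 0 = 0) (y : ℂ) :
    Integrable (h y • (f ⁻¹' {y}).indicator (1 : Rn n → ℂ)) := by
  by_cases hy : y = 0
  · rw [hy, h0, zero_smul]
    exact integrable_zero _ _ _
  · refine Integrable.smul _ ?_
    rw [integrable_indicator_iff (f.measurableSet_preimage {y})]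
    exact integrableOn_const (SimpleFunc.integrable_iff.1 hf y hy).ne

/-- The Fourier pairing of simple functions as a finite sum. -/
theorem integral_unitaryFourier_simpleFunc_mul {f g : SimpleFunc (Rn n) ℂ} (hf : Integrable f)
    (hg : Integrable g) {h : ℂ → ℂ} (h0 : h 0 = 0) :
    ∫ ξ, unitaryFourier (fun x => h (f x)) ξ * h (g ξ) =
      ∑ y ∈ f.range, ∑ w ∈ g.range, h y * h w *
        ∫ ξ, unitaryFourier ((f ⁻¹' {y}).indicator 1) ξ * (g ⁻¹' {w}).indicator 1 ξ := by
  have e : ∀ ξ, unitaryFourier (fun x => h (f x)) ξ * h (g ξ) = ∑ y ∈ f.range, ∑ w ∈ g.range,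
      unitaryFourier (h y • (f ⁻¹' {y}).indicator (1 : Rn n → ℂ)) ξ *
        (h w • (g ⁻¹' {w}).indicator (1 : Rn n → ℂ)) ξ := by
    intro ξ
    have e2 := congrFun (simpleFunc_comp_eq_sum g (h := h)) ξ
    rw [simpleFunc_comp_eq_sum f, unitaryFourier_sum _
      fun y _ => integrable_smul_indicator_preimage hf h0 y]
    rw [e2, Finset.sum_apply, Finset.sum_apply, Finset.sum_mul_sum]
  simp_rw [e]
  have hi : ∀ y w, Integrable fun ξ =>
      unitaryFourier (h y • (f ⁻¹' {y}).indicator (1 : Rn n → ℂ)) ξ *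
        (h w • (g ⁻¹' {w}).indicator (1 : Rn n → ℂ)) ξ := fun y w =>
    integrable_unitaryFourier_mul (integrable_smul_indicator_preimage hf h0 y)
      (integrable_smul_indicator_preimage hg h0 w)
  rw [integral_finsetSum _ fun y _ => integrable_finsetSum _ fun w _ => hi y w]
  refine Finset.sum_congr rfl fun y _ => ?_
  rw [integral_finsetSum _ fun w _ => hi y w]
  refine Finset.sum_congr rfl fun w _ => ?_
  rw [← integral_const_mul]
  congr 1
  ext ξ
  rw [unitaryFourier_const_smul]
  simp only [Pi.smul_apply, smul_eq_mul]
  ring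

/-- The endpoint `Re z = 0`. -/
theorem norm_integral_unitaryFourier_mul_le {f g : Rn n → ℂ} (hg : Integrable g) :
    ‖∫ ξ, unitaryFourier f ξ * g ξ‖ ≤ (∫ x, ‖f x‖) * ∫ x, ‖g x‖ := by
  rw [← integral_const_mul]
  refine norm_integral_le_of_norm_le (hg.norm.const_mul _) (Filter.Eventually.of_forall fun ξ => ?_)
  rw [norm_mul]
  gcongr
  exact norm_unitaryFourier_le f ξ

/-- The endpoint `Re z = 1`: Cauchy–Schwarz and Plancherel. -/
theorem norm_integral_unitaryFourier_mul_le_two {f g : Rn n → ℂ} (hf : Integrable f)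
    (hf2 : MemLp f 2 volume) (hg2 : MemLp g 2 volume) :
    ‖∫ ξ, unitaryFourier f ξ * g ξ‖ ≤
      (∫ x, ‖f x‖ ^ (2 : ℝ)) ^ (2⁻¹ : ℝ) * (∫ x, ‖g x‖ ^ (2 : ℝ)) ^ (2⁻¹ : ℝ) := by
  have h1 : ‖∫ ξ, unitaryFourier f ξ * g ξ‖ₑ ≤ eLpNorm f 2 volume * eLpNorm g 2 volume := by
    rw [← eLpNorm_two_unitaryFourier hf hf2]
    refine (enorm_integral_le_lintegral_enorm _).trans ?_
    rw [← eLpNorm_one_eq_lintegral_enorm]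
    change eLpNorm (unitaryFourier f • g) 1 volume ≤ _
    exact eLpNorm_smul_le_mul_eLpNorm (p := 2) (q := 2) (r := 1) hg2.1
      (continuous_unitaryFourier hf).aestronglyMeasurable
  rw [hf2.eLpNorm_eq_integral_rpow_norm (by simp) (by simp),
    hg2.eLpNorm_eq_integral_rpow_norm (by simp) (by simp), ← ENNReal.ofReal_mul (by positivity),
    ← ofReal_norm, ENNReal.ofReal_le_ofReal_iff (by positivity)] at h1
  simpa using h1

/-- Boundedness of the Fourier pairing of simple functions on `L^p × L^p`, `1 ≤ p ≤ 2`. -/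
theorem norm_integral_unitaryFourier_mul_le_rpow {f g : SimpleFunc (Rn n) ℂ} (hf : Integrable f)
    (hg : Integrable g) {p : ℝ} (hp1 : 1 ≤ p) (hp2 : p ≤ 2) :
    ‖∫ ξ, unitaryFourier f ξ * g ξ‖ ≤
      (∫ x, ‖f x‖ ^ p) ^ p⁻¹ * (∫ x, ‖g x‖ ^ p) ^ p⁻¹ := by
  have hp0 : 0 < p := by linarith
  set A := ∫ x, ‖f x‖ ^ p
  set B := ∫ x, ‖g x‖ ^ p
  have hA : 0 ≤ A := integral_nonneg fun x => by positivity
  have hB : 0 ≤ B := integral_nonneg fun x => by positivity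
  set Φ : ℂ → ℂ := fun z => ∫ ξ, unitaryFourier (fun x => powFamily p z (f x)) ξ *
    powFamily p z (g ξ)
  have hΦ : ∀ z, Φ z = _ := fun z =>
    integral_unitaryFourier_simpleFunc_mul hf hg (powFamily_zero p z)
  have hmem : ∀ {f : SimpleFunc (Rn n) ℂ}, Integrable f → ∀ (z : ℂ) (q : ℝ≥0∞), q ≠ 0 → q ≠ ∞ →
      MemLp (fun x => powFamily p z (f x)) q volume := by
    intro f hf z q hq0 hq
    have := (SimpleFunc.finMeasSupp_iff.2 (SimpleFunc.integrable_iff.1 hf)).map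
      (powFamily_zero p z)
    exact (SimpleFunc.memLp_iff hq0 hq).2 (SimpleFunc.finMeasSupp_iff.1 this)
  have hintegrable : ∀ {f : SimpleFunc (Rn n) ℂ}, Integrable f → ∀ z : ℂ,
      Integrable (fun x => powFamily p z (f x)) := fun hf z =>
    memLp_one_iff_integrable.1 (hmem hf z 1 (by simp) (by simp))
  have hdiff : Differentiable ℂ Φ := by
    rw [funext hΦ]
    have := differentiable_powFamily p
    fun_prop
  -- Solves `p (1 - θ/2) = 1`, so `powFamily p θ` is the identity.
  set θ : ℝ := 2 - 2 / p
  have hθ0 : 0 ≤ θ := by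
    have : 2 / p ≤ 2 := div_le_self (by norm_num) hp1
    simp only [θ]; linarith
  have hθ1 : θ ≤ 1 := by
    have : 1 ≤ 2 / p := (one_le_div hp0).2 hp2
    simp only [θ]; linarith
  have hθp : p * (1 - θ / 2) = 1 := by
    simp only [θ]
    field_simp
    ring
  have hbdd : BddAbove ((norm ∘ Φ) '' Complex.HadamardThreeLines.verticalClosedStrip 0 1) := by
    refine ⟨∑ y ∈ f.range, ∑ w ∈ g.range,
      Real.exp (p * |Real.log ‖y‖|) * Real.exp (p * |Real.log ‖w‖|) *
      ‖∫ ξ, unitaryFourier ((f ⁻¹' {y}).indicator 1) ξ * (g ⁻¹' {w}).indicator 1 ξ‖, ?_⟩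
    rintro _ ⟨z, hz, rfl⟩
    simp only [Complex.HadamardThreeLines.verticalClosedStrip, Set.mem_preimage, Set.mem_Icc] at hz
    rw [Function.comp_apply, hΦ]
    refine (norm_sum_le _ _).trans (Finset.sum_le_sum fun y _ => ?_)
    refine (norm_sum_le _ _).trans (Finset.sum_le_sum fun w _ => ?_)
    rw [norm_mul, norm_mul]
    gcongr
    · exact norm_powFamily_le hp0.le hz.1 hz.2 y
    · exact norm_powFamily_le hp0.le hz.1 hz.2 w
  -- Here the family has modulus `|y|^p`, with `L¹` norms `A` and `B`.
  have h0 : ∀ z ∈ Complex.re ⁻¹' {0}, ‖Φ z‖ ≤ A * B := by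
    intro z hz
    simp only [Set.mem_preimage, Set.mem_singleton_iff] at hz
    refine (norm_integral_unitaryFourier_mul_le (hintegrable hg z)).trans (le_of_eq ?_)
    simp only [norm_powFamily (p := p) (z := z) (by rw [hz]; linarith), hz]
    simp [A, B]
  -- Here the modulus is `|y|^{p/2}`, with `L²` norms `A^{1/2}` and `B^{1/2}`.
  have h1 : ∀ z ∈ Complex.re ⁻¹' {1}, ‖Φ z‖ ≤ A ^ (2⁻¹ : ℝ) * B ^ (2⁻¹ : ℝ) := by
    intro z hz
    simp only [Set.mem_preimage, Set.mem_singleton_iff] at hz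
    refine (norm_integral_unitaryFourier_mul_le_two (hintegrable hf z)
      (hmem hf z 2 (by simp) (by simp)) (hmem hg z 2 (by simp) (by simp))).trans (le_of_eq ?_)
    simp only [norm_powFamily (p := p) (z := z) (by rw [hz]; linarith), hz]
    have : ∀ y : ℂ, (‖y‖ ^ (p * (1 - 1 / 2))) ^ (2 : ℝ) = ‖y‖ ^ p := by
      intro y
      rw [← Real.rpow_mul (norm_nonneg _)]
      congr 1
      ring
    simp only [this, A, B]
  have key := Complex.HadamardThreeLines.norm_le_interp_of_mem_verticalClosedStrip₀₁' Φ
    (z := (θ : ℂ)) (by simpa [Complex.HadamardThreeLines.verticalClosedStrip] using ⟨hθ0, hθ1⟩)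
    hdiff.diffContOnCl hbdd h0 h1
  have hΦθ : Φ θ = ∫ ξ, unitaryFourier f ξ * g ξ := by
    have : ∀ y, powFamily p θ y = y := powFamily_eq_self (by exact_mod_cast hθp)
    simp only [Φ, this]
  rw [hΦθ, Complex.ofReal_re] at key
  refine key.trans (le_of_eq ?_)
  have hexp : (1 - θ) + 2⁻¹ * θ = p⁻¹ := by
    simp only [θ]
    field_simp
    ring
  -- A nonzero total exponent allows the powers to be added even if `A * B = 0`.
  have hexp0 : (1 - θ) + 2⁻¹ * θ ≠ 0 := by rw [hexp]; positivity
  rw [← Real.mul_rpow hA hB, ← Real.rpow_mul (mul_nonneg hA hB),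
    ← Real.rpow_add' (mul_nonneg hA hB) hexp0, hexp, Real.mul_rpow hA hB]


/-! ### The Hausdorff–Young inequality -/

theorem enorm_integral_unitaryFourier_mul_le_of_simpleFunc {f g : SimpleFunc (Rn n) ℂ}
    (hf : Integrable f) (hg : Integrable g) {p : ℝ≥0∞} (hp1 : 1 ≤ p) (hp2 : p ≤ 2) :
    ‖∫ ξ, unitaryFourier f ξ * g ξ‖ₑ ≤ eLpNorm f p volume * eLpNorm g p volume := by
  have hp0 : p ≠ 0 := (one_pos.trans_le hp1).ne'
  have hpt : p ≠ ∞ := (hp2.trans_lt (by simp)).ne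
  have hmem : ∀ {f : SimpleFunc (Rn n) ℂ}, Integrable f → MemLp f p volume := fun hf =>
    (SimpleFunc.memLp_iff hp0 hpt).2 (SimpleFunc.integrable_iff.1 hf)
  rw [(hmem hf).eLpNorm_eq_integral_rpow_norm hp0 hpt,
    (hmem hg).eLpNorm_eq_integral_rpow_norm hp0 hpt, ← ENNReal.ofReal_mul (by positivity),
    ← ofReal_norm]
  refine ENNReal.ofReal_le_ofReal (norm_integral_unitaryFourier_mul_le_rpow hf hg ?_ ?_)
  · simpa using ENNReal.toReal_mono hpt hp1
  · simpa using ENNReal.toReal_mono (by simp) hp2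

/-- Simultaneous approximation by simple functions in `L¹` and `L^p`. -/
theorem exists_simpleFunc_tendsto_eLpNorm {f : Rn n → ℂ} (hfm : Measurable f) (hf : Integrable f)
    {p : ℝ≥0∞} (hp : p ≠ ∞) (hfp : MemLp f p volume) :
    ∃ G : ℕ → SimpleFunc (Rn n) ℂ, (∀ k, Integrable (G k)) ∧
      Filter.Tendsto (fun k => eLpNorm (⇑(G k) - f) 1 volume) Filter.atTop (nhds 0) ∧
      Filter.Tendsto (fun k => eLpNorm (⇑(G k) - f) p volume) Filter.atTop (nhds 0) :=
  ⟨fun k => SimpleFunc.approxOn f hfm (Set.range f ∪ {0}) 0 (by simp) k,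
    SimpleFunc.integrable_approxOn_range hfm hf,
    SimpleFunc.tendsto_approxOn_range_Lp_eLpNorm (by simp) hfm (memLp_one_iff_integrable.2 hf).2,
    SimpleFunc.tendsto_approxOn_range_Lp_eLpNorm hp hfm hfp.2⟩

/-- The test function used for duality is not simple. In the approximation, `L^p` convergence
preserves the bound and `L¹` convergence kills the error in the pairing. -/
theorem enorm_integral_unitaryFourier_mul_le {f : SimpleFunc (Rn n) ℂ} {g : Rn n → ℂ}
    (hf : Integrable f) (hgm : Measurable g) (hg : Integrable g) {p : ℝ≥0∞} (hp1 : 1 ≤ p)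
    (hp2 : p ≤ 2) (hgp : MemLp g p volume) :
    ‖∫ ξ, unitaryFourier f ξ * g ξ‖ₑ ≤ eLpNorm f p volume * eLpNorm g p volume := by
  have hp0 : p ≠ 0 := (one_pos.trans_le hp1).ne'
  have hpt : p ≠ ∞ := (hp2.trans_lt (by simp)).ne
  obtain ⟨G, hG, h1, h2⟩ := exists_simpleFunc_tendsto_eLpNorm hgm hg hpt hgp
  have hfp : MemLp f p volume := (SimpleFunc.memLp_iff hp0 hpt).2 (SimpleFunc.integrable_iff.1 hf)
  have hbound : ∀ k, ‖∫ ξ, unitaryFourier f ξ * g ξ‖ₑ ≤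
      eLpNorm f p volume * (eLpNorm g p volume + eLpNorm (⇑(G k) - g) p volume)
      + ENNReal.ofReal (∫ x, ‖f x‖) * eLpNorm (⇑(G k) - g) 1 volume := by
    intro k
    have e : ∫ ξ, unitaryFourier f ξ * g ξ = (∫ ξ, unitaryFourier f ξ * G k ξ)
        - ∫ ξ, unitaryFourier f ξ * (⇑(G k) - g) ξ := by
      rw [← integral_sub (integrable_unitaryFourier_mul hf (hG k))
        (integrable_unitaryFourier_mul hf ((hG k).sub hg))]
      congr 1
      ext ξ
      rw [Pi.sub_apply]
      ring
    rw [e]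
    refine (enorm_sub_le).trans (add_le_add ?_ ?_)
    · refine (enorm_integral_unitaryFourier_mul_le_of_simpleFunc hf (hG k) hp1 hp2).trans ?_
      gcongr
      have e2 : (G k : Rn n → ℂ) = g + (⇑(G k) - g) := by abel
      conv_lhs => rw [e2]
      exact eLpNorm_add_le hgp.1 ((G k).measurable.sub hgm).aestronglyMeasurable hp1
    · rw [eLpNorm_one_eq_lintegral_enorm]
      have h3 := norm_integral_unitaryFourier_mul_le (f := f) ((hG k).sub hg)
      rw [← ofReal_norm, ← ofReal_integral_norm_eq_lintegral_enorm ((hG k).sub hg),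
        ← ENNReal.ofReal_mul (by positivity)]
      exact ENNReal.ofReal_le_ofReal h3
  refine ge_of_tendsto' (x := Filter.atTop) ?_ hbound
  have t1 := ENNReal.Tendsto.const_mul (a := eLpNorm f p volume)
    (h2.const_add (eLpNorm g p volume)) (Or.inr hfp.2.ne)
  have t2 := ENNReal.Tendsto.const_mul (a := ENNReal.ofReal (∫ x, ‖f x‖)) h1
    (Or.inr ENNReal.ofReal_ne_top)
  simpa using t1.add t2

/-- Duality: the pairing is tested against the extremal function for Hölder. Restricting to a ball
makes every norm finite, so that one can divide. -/
theorem eLpNorm_indicator_ball_unitaryFourier_le {f : SimpleFunc (Rn n) ℂ} (hf : Integrable f)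
    {p : ℝ} (hp1 : 1 < p) (hp2 : p ≤ 2) {q : ℝ} (hpq : p.HolderConjugate q) (R : ℝ) :
    eLpNorm ((Metric.ball 0 R).indicator (unitaryFourier f)) (ENNReal.ofReal q) volume ≤
      eLpNorm f (ENNReal.ofReal p) volume := by
  have hq1 : 1 < q := hpq.symm.lt
  have hq2 : 2 ≤ q := by
    have := hpq.inv_add_inv_eq_one
    have h3 : (2 : ℝ)⁻¹ ≤ p⁻¹ := inv_anti₀ (by linarith) hp2
    have h4 : q⁻¹ ≤ 2⁻¹ := by linarith
    exact (inv_le_inv₀ (by linarith) (by norm_num)).1 h4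
  have hsub : (q - 1) * p = q := hpq.symm.sub_one_mul_conj
  set h := unitaryFourier f
  set U : Set (Rn n) := Metric.ball 0 R
  have hU : MeasurableSet U := Metric.isOpen_ball.measurableSet
  have hUfin : volume U < ∞ := measure_ball_lt_top
  have hfinite : IsFiniteMeasure (volume.restrict U) := ⟨by simpa using hUfin⟩
  have hcont : Continuous h := continuous_unitaryFourier hf
  -- `h * k = |h|^q` and `|k|^p = |h|^{(q-1)p} = |h|^q`; since `q ≥ 2`, `k` is continuous also at
  -- the zeros of `h`.
  set k : Rn n → ℂ := fun ξ => starRingEnd ℂ (h ξ) * ((‖h ξ‖ ^ (q - 2) : ℝ) : ℂ)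
  have hk : Continuous k := by
    refine (Complex.continuous_conj.comp hcont).mul (Complex.continuous_ofReal.comp ?_)
    exact hcont.norm.rpow_const fun _ => Or.inr (by linarith)
  have hknorm : ∀ ξ, ‖k ξ‖ = ‖h ξ‖ ^ (q - 1) := by
    intro ξ
    rw [norm_mul, Complex.norm_real, RCLike.norm_conj, Real.norm_of_nonneg (by positivity)]
    nth_rewrite 1 [← Real.rpow_one ‖h ξ‖]
    rw [← Real.rpow_add' (norm_nonneg _) (by linarith)]
    congr 1
    ring
  have hhk : ∀ ξ, h ξ * k ξ = ((‖h ξ‖ ^ q : ℝ) : ℂ) := by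
    intro ξ
    rw [← mul_assoc, Complex.mul_conj, Complex.normSq_eq_norm_sq, ← Complex.ofReal_mul,
      ← Real.rpow_natCast, ← Real.rpow_add' (norm_nonneg _) (by push_cast; linarith)]
    congr 2
    push_cast
    ring
  set M := ∫ x, ‖f x‖
  have hM : 0 ≤ M := integral_nonneg fun x => norm_nonneg _
  have hhM : ∀ ξ, ‖h ξ‖ ≤ M := norm_unitaryFourier_le f
  have hmem : ∀ r : ℝ≥0∞, MemLp (U.indicator k) r volume := fun r => by
    rw [memLp_indicator_iff_restrict hU]
    refine MemLp.of_bound hk.aestronglyMeasurable (M ^ (q - 1)) (Filter.Eventually.of_forall ?_)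
    intro ξ
    rw [hknorm]
    exact Real.rpow_le_rpow (norm_nonneg _) (hhM ξ) (by linarith)
  have key := enorm_integral_unitaryFourier_mul_le hf (hk.measurable.indicator hU)
    (memLp_one_iff_integrable.1 (hmem 1)) (p := ENNReal.ofReal p) (by simpa using hp1.le)
    (by simpa using ENNReal.ofReal_le_ofReal hp2) (hmem _)
  have hintegrable : Integrable (fun ξ => ‖h ξ‖ ^ q) (volume.restrict U) := by
    rw [← memLp_one_iff_integrable]
    refine MemLp.of_bound (hcont.norm.rpow_const
      fun _ => Or.inr (by linarith)).aestronglyMeasurable (M ^ q) (Filter.Eventually.of_forall ?_)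
    intro ξ
    rw [Real.norm_of_nonneg (by positivity)]
    exact Real.rpow_le_rpow (norm_nonneg _) (hhM ξ) (by linarith)
  set I := ∫⁻ ξ in U, ‖h ξ‖ₑ ^ q
  have hI : I = ENNReal.ofReal (∫ ξ in U, ‖h ξ‖ ^ q) := by
    rw [ofReal_integral_eq_lintegral_ofReal hintegrable (Filter.Eventually.of_forall fun ξ => by positivity)]
    refine lintegral_congr fun ξ => ?_
    rw [← ENNReal.ofReal_rpow_of_nonneg (norm_nonneg _) (by linarith), ofReal_norm]
  have hIt : I ≠ ∞ := by
    rw [hI]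
    exact ENNReal.ofReal_ne_top
  have e1 : ‖∫ ξ, h ξ * U.indicator k ξ‖ₑ = I := by
    have : ∀ ξ, h ξ * U.indicator k ξ = U.indicator (fun ξ => ((‖h ξ‖ ^ q : ℝ) : ℂ)) ξ := by
      intro ξ
      by_cases hξ : ξ ∈ U
      · simp only [Set.indicator_of_mem hξ, hhk]
      · simp only [Set.indicator_of_notMem hξ, mul_zero]
    simp_rw [this]
    rw [integral_indicator hU, integral_complex_ofReal, hI, ← ofReal_norm, Complex.norm_real,
      Real.norm_of_nonneg (integral_nonneg fun ξ => by positivity)]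
  have hpp : ENNReal.ofReal p ≠ 0 := by simpa using by linarith
  have hqq : ENNReal.ofReal q ≠ 0 := by simpa using by linarith
  have e2 : eLpNorm (U.indicator k) (ENNReal.ofReal p) volume = I ^ (1 / p) := by
    rw [eLpNorm_indicator_eq_eLpNorm_restrict hU,
      eLpNorm_eq_lintegral_rpow_enorm_toReal hpp ENNReal.ofReal_ne_top,
      ENNReal.toReal_ofReal (by linarith)]
    congr 1
    refine lintegral_congr fun ξ => ?_
    rw [← ofReal_norm, hknorm, ENNReal.ofReal_rpow_of_nonneg (by positivity) (by linarith),
      ← Real.rpow_mul (norm_nonneg _), hsub, ← ofReal_norm,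
      ENNReal.ofReal_rpow_of_nonneg (norm_nonneg _) (by linarith)]
  have e3 : eLpNorm (U.indicator h) (ENNReal.ofReal q) volume = I ^ (1 / q) := by
    rw [eLpNorm_indicator_eq_eLpNorm_restrict hU,
      eLpNorm_eq_lintegral_rpow_enorm_toReal hqq ENNReal.ofReal_ne_top,
      ENNReal.toReal_ofReal (by linarith)]
  rw [e1, e2] at key
  rw [e3]
  by_cases hI0 : I = 0
  · rw [hI0, ENNReal.zero_rpow_of_pos (by positivity)]
    exact zero_le
  -- `key` reads `I ≤ ‖f‖_p I^{1/p}`; cancelling the finite nonzero factor `I^{1/p}` leaves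
  -- `I^{1/q}`.
  · have hsplit : I = I ^ (1 / q) * I ^ (1 / p) := by
      rw [← ENNReal.rpow_add _ _ hI0 hIt]
      have : 1 / q + 1 / p = 1 := by
        have := hpq.inv_add_inv_eq_one
        simp only [one_div]
        linarith
      rw [this, ENNReal.rpow_one]
    conv_lhs at key => rw [hsplit]
    refine (ENNReal.mul_le_mul_iff_left ?_ ?_).1 key
    · exact (ENNReal.rpow_pos (pos_iff_ne_zero.2 hI0) hIt).ne'
    · exact ENNReal.rpow_ne_top_of_nonneg (by positivity) hIt

/-- Fatou along balls of radius `k → ∞`. -/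
theorem eLpNorm_unitaryFourier_le_of_simpleFunc {f : SimpleFunc (Rn n) ℂ} (hf : Integrable f)
    {p : ℝ} (hp1 : 1 < p) (hp2 : p ≤ 2) {q : ℝ} (hpq : p.HolderConjugate q) :
    eLpNorm (unitaryFourier f) (ENNReal.ofReal q) volume ≤
      eLpNorm f (ENNReal.ofReal p) volume := by
  have hc := continuous_unitaryFourier hf
  have hlim := Lp.eLpNorm_lim_le_liminf_eLpNorm (p := ENNReal.ofReal q) (μ := volume)
    (f := fun k : ℕ => (Metric.ball (0 : Rn n) k).indicator (unitaryFourier f))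
    (fun k => hc.aestronglyMeasurable.indicator Metric.isOpen_ball.measurableSet)
    (unitaryFourier f) (Filter.Eventually.of_forall fun ξ => ?_)
  · refine hlim.trans (Filter.liminf_le_of_le (by isBoundedDefault) fun b hb => ?_)
    obtain ⟨k, hk⟩ := hb.exists
    exact hk.trans (eLpNorm_indicator_ball_unitaryFourier_le hf hp1 hp2 hpq k)
  · refine tendsto_const_nhds.congr' ?_
    obtain ⟨K, hK⟩ := exists_nat_gt ‖ξ‖
    filter_upwards [Filter.eventually_ge_atTop K] with k hk
    rw [Set.indicator_of_mem]
    rw [mem_ball_zero_iff]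
    exact hK.trans_le (by exact_mod_cast hk)

/-- The Hausdorff–Young inequality on `L¹ ∩ L^p`. -/
theorem eLpNorm_unitaryFourier_le {f : Rn n → ℂ} (hfm : Measurable f) (hf : Integrable f)
    {p q : ℝ≥0∞} (hp1 : 1 ≤ p) (hp2 : p ≤ 2) (hpq : p.HolderConjugate q)
    (hfp : MemLp f p volume) :
    eLpNorm (unitaryFourier f) q volume ≤ eLpNorm f p volume := by
  have hpt : p ≠ ∞ := (hp2.trans_lt (by simp)).ne
  rcases hp1.eq_or_lt with rfl | hp1'
  -- At `p = 1` duality is replaced by the sup bound.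
  · have hq : q = ∞ := by
      have := hpq.conj_eq
      simpa using this
    rw [hq, eLpNorm_one_eq_lintegral_enorm, ← ofReal_integral_norm_eq_lintegral_enorm hf,
      eLpNorm_exponent_top]
    exact eLpNormEssSup_le_of_ae_bound (Filter.Eventually.of_forall (norm_unitaryFourier_le f))
  have hqt : q ≠ ∞ := by
    rw [hpq.conj_eq]
    simp [tsub_eq_zero_iff_le, hp1']
  have hq1 : 1 ≤ q := by
    rw [hpq.conj_eq]
    exact le_self_add
  have hr1 : 1 < p.toReal := by
    simpa using (ENNReal.toReal_lt_toReal (by simp) hpt).2 hp1'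
  have hr2 : p.toReal ≤ 2 := by simpa using ENNReal.toReal_mono (by simp) hp2
  have hreal : p.toReal.HolderConjugate q.toReal := by
    rw [Real.holderConjugate_iff]
    refine ⟨hr1, ?_⟩
    have := hpq.inv_add_inv_eq_one
    rw [← ENNReal.toReal_inv, ← ENNReal.toReal_inv, ← ENNReal.toReal_add, this, ENNReal.toReal_one]
    · simpa using (one_pos.trans_le hp1).ne'
    · simpa using (one_pos.trans_le hq1).ne'
  obtain ⟨G, hG, h1, h2⟩ := exists_simpleFunc_tendsto_eLpNorm hfm hf hpt hfp
  have hle : ∀ k, eLpNorm (unitaryFourier (G k)) q volume ≤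
      eLpNorm f p volume + eLpNorm (⇑(G k) - f) p volume := by
    intro k
    have := eLpNorm_unitaryFourier_le_of_simpleFunc (hG k) hr1 hr2 hreal
    rw [ENNReal.ofReal_toReal hqt, ENNReal.ofReal_toReal hpt] at this
    refine this.trans ?_
    have e2 : (G k : Rn n → ℂ) = f + (⇑(G k) - f) := by abel
    conv_lhs => rw [e2]
    exact eLpNorm_add_le hfp.1 ((G k).measurable.sub hfm).aestronglyMeasurable hp1
  have hlim := Lp.eLpNorm_lim_le_liminf_eLpNorm (p := q) (μ := volume)
    (f := fun k : ℕ => unitaryFourier (G k))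
    (fun k => (continuous_unitaryFourier (hG k)).aestronglyMeasurable)
    (unitaryFourier f) (Filter.Eventually.of_forall fun ξ => ?_)
  · refine hlim.trans ((Filter.liminf_le_liminf (Filter.Eventually.of_forall hle)).trans ?_)
    have := (h2.const_add (eLpNorm f p volume)).liminf_eq
    rw [this, add_zero]
  -- `L¹` convergence gives pointwise convergence of the transforms, as Fatou requires.
  · rw [tendsto_iff_edist_tendsto_0]
    refine tendsto_of_tendsto_of_tendsto_of_le_of_le tendsto_const_nhds h1 (fun _ => zero_le)
      fun k => ?_
    have e3 := congrFun (unitaryFourier_sub (hG k) hf) ξ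
    simp only [edist_eq_enorm_sub]
    rw [Pi.sub_apply] at e3
    rw [← e3, eLpNorm_one_eq_lintegral_enorm,
      ← ofReal_integral_norm_eq_lintegral_enorm ((hG k).sub hf), ← ofReal_norm]
    exact ENNReal.ofReal_le_ofReal (norm_unitaryFourier_le _ ξ)


/-! ### Hausdorff–Young for distributions and the constant `c_{n,p}` -/

theorem holderConjugate_div_sub_one {p : ℝ≥0∞} (hp1 : 1 ≤ p) (hp : p ≠ ∞) :
    p.HolderConjugate (p / (p - 1)) := by
  rw [ENNReal.isConjExponent_iff_eq_conjExponent hp1]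
  rcases hp1.eq_or_lt with rfl | h
  · simp
  · have h0 : p - 1 ≠ 0 := by simpa [tsub_eq_zero_iff_le] using h
    have ht : p - 1 ≠ ∞ := ENNReal.sub_ne_top hp
    nth_rewrite 1 [← tsub_add_cancel_of_le hp1]
    rw [ENNReal.add_div, ENNReal.div_self h0 ht, one_div]

theorem norm_toLp_schwartzFourier_le {p q : ℝ≥0∞} [Fact (1 ≤ p)] [Fact (1 ≤ q)] (hp2 : p ≤ 2)
    (hpq : p.HolderConjugate q) (φ : 𝓢(Rn n, ℂ)) :
    ‖(schwartzFourier n φ).toLp q‖ ≤ ‖φ.toLp p‖ := by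
  rw [SchwartzMap.norm_toLp, SchwartzMap.norm_toLp]
  refine ENNReal.toReal_mono (φ.memLp p volume).2.ne ?_
  rw [schwartzFourier_eq_unitaryFourier]
  exact eLpNorm_unitaryFourier_le φ.continuous.measurable φ.integrable Fact.out hp2 hpq
    (φ.memLp p volume)

theorem fourier_toTemperedDistribution_toLp {p q : ℝ≥0∞} [Fact (1 ≤ p)] [Fact (1 ≤ q)]
    (φ : 𝓢(Rn n, ℂ)) : fourier n (Lp.toTemperedDistribution (φ.toLp p)) =
      Lp.toTemperedDistribution ((schwartzFourier n φ).toLp q) := by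
  ext ψ
  have h := integral_unitaryFourier_mul_eq (φ.integrable (μ := volume))
    (ψ.integrable (μ := volume))
  have e1 : fourier n (Lp.toTemperedDistribution (φ.toLp p)) ψ =
      Lp.toTemperedDistribution (φ.toLp p) (schwartzFourier n ψ) := rfl
  rw [e1, Lp.toTemperedDistribution_apply, Lp.toTemperedDistribution_apply]
  refine Eq.trans (integral_congr_ae ?_) (h.symm.trans (integral_congr_ae ?_))
  · filter_upwards [φ.coeFn_toLp p volume] with x hx
    rw [hx, schwartzFourier_eq_unitaryFourier, smul_eq_mul, mul_comm]
  · filter_upwards [(schwartzFourier n φ).coeFn_toLp q volume] with x hx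
    rw [hx, schwartzFourier_eq_unitaryFourier, smul_eq_mul, mul_comm]

/-- The **Hausdorff–Young inequality** for tempered distributions given by `L^p` functions. -/
theorem exists_fourier_toTemperedDistribution_eq {p q : ℝ≥0∞} [Fact (1 ≤ p)] [Fact (1 ≤ q)]
    (hp2 : p ≤ 2) (hpq : p.HolderConjugate q) (v : Lp ℂ p (volume : Measure (Rn n))) :
    ∃ w : Lp ℂ q (volume : Measure (Rn n)), ‖w‖ ≤ ‖v‖ ∧
      fourier n (Lp.toTemperedDistribution v) = Lp.toTemperedDistribution w := by
  have hpt : p ≠ ∞ := (hp2.trans_lt (by simp)).ne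
  set S : 𝓢(Rn n, ℂ) →ₗ[ℂ] Lp ℂ q (volume : Measure (Rn n)) :=
    (SchwartzMap.toLpCLM ℂ ℂ q volume ∘L schwartzFourier n).toLinearMap
  set e : 𝓢(Rn n, ℂ) →ₗ[ℂ] Lp ℂ p (volume : Measure (Rn n)) :=
    (SchwartzMap.toLpCLM ℂ ℂ p volume).toLinearMap
  have hd : DenseRange e := SchwartzMap.denseRange_toLpCLM hpt
  have hb : ∀ φ, ‖S φ‖ ≤ 1 * ‖e φ‖ := fun φ => by
    rw [one_mul]
    exact norm_toLp_schwartzFourier_le hp2 hpq φ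
  refine ⟨S.extendOfNorm e v, ?_, ?_⟩
  · simpa using LinearMap.norm_extendOfNorm_apply_le hd 1 hb v
  -- Both sides are continuous in `v` with values in `𝓢'`, so it suffices to compare them on
  -- Schwartz functions.
  · refine DenseRange.induction_on (p := fun v => fourier n (Lp.toTemperedDistribution v) =
      Lp.toTemperedDistribution (S.extendOfNorm e v)) hd v ?_ fun φ => ?_
    · apply isClosed_eq
      · exact (fourier n ∘L Lp.toTemperedDistributionCLM ℂ volume p).continuous
      · exact (Lp.toTemperedDistributionCLM ℂ volume q ∘L S.extendOfNorm e).continuous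
    · rw [LinearMap.extendOfNorm_eq hd ⟨1, hb⟩]
      exact fourier_toTemperedDistribution_toLp φ

theorem IsRepresentedBy.eq_toTemperedDistribution {p : ℝ≥0∞} [Fact (1 ≤ p)] {u : 𝓢'(Rn n, ℂ)}
    {v : Rn n → ℂ} (h : IsRepresentedBy u v) (hv : MemLp v p volume) :
    u = Lp.toTemperedDistribution (hv.toLp v) := by
  ext φ
  rw [(h.2 φ).2, Lp.toTemperedDistribution_apply]
  refine integral_congr_ae ?_
  filter_upwards [hv.coeFn_toLp] with x hx
  rw [hx, smul_eq_mul]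

theorem lpNorm_toTemperedDistribution {p : ℝ≥0∞} [Fact (1 ≤ p)]
    (v : Lp ℂ p (volume : Measure (Rn n))) : lpNorm p (Lp.toTemperedDistribution v) = ‖v‖ₑ := by
  rw [(isRepresentedBy_toTemperedDistribution v).lpNorm_eq, Lp.enorm_def]

theorem isLp_toTemperedDistribution {p : ℝ≥0∞} [Fact (1 ≤ p)]
    (v : Lp ℂ p (volume : Measure (Rn n))) : IsLp p (Lp.toTemperedDistribution v) :=
  ⟨v, isRepresentedBy_toTemperedDistribution v, Lp.memLp v⟩

/-- The **Hausdorff–Young inequality**. -/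
theorem IsLp.fourier {p : ℝ≥0∞} (hp1 : 1 ≤ p) (hp2 : p ≤ 2) {u : 𝓢'(Rn n, ℂ)} (hu : IsLp p u) :
    IsLp (p / (p - 1)) (fourier n u) ∧ lpNorm (p / (p - 1)) (FourierPhase.fourier n u)
      ≤ lpNorm p u := by
  have hpt : p ≠ ∞ := (hp2.trans_lt (by simp)).ne
  have hpq := holderConjugate_div_sub_one hp1 hpt
  have : Fact (1 ≤ p) := ⟨hp1⟩
  have : Fact (1 ≤ p / (p - 1)) := ⟨by rw [hpq.conj_eq]; exact le_self_add⟩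
  obtain ⟨v, hv, hvp⟩ := hu
  rw [hv.eq_toTemperedDistribution hvp]
  obtain ⟨w, hw, hfw⟩ := exists_fourier_toTemperedDistribution_eq hp2 hpq (hvp.toLp v)
  rw [hfw, lpNorm_toTemperedDistribution, lpNorm_toTemperedDistribution]
  exact ⟨⟨w, isRepresentedBy_toTemperedDistribution w, Lp.memLp w⟩, enorm_le_iff_norm_le.2 hw⟩

theorem fourierConst_le_one {p : ℝ≥0∞} (hp1 : 1 ≤ p) (hp2 : p ≤ 2) : fourierConst n p ≤ 1 := by
  refine pow_le_one₀ zero_le (sInf_le fun u hu => ?_)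
  rw [one_mul]
  exact (hu.fourier hp1 hp2).2

/-- The infimum of the admissible constants is itself admissible: divide by `‖u‖_p` when it is
nonzero. -/
theorem lpNorm_fourier_sq_le {p : ℝ≥0∞} (hp1 : 1 ≤ p) (hp2 : p ≤ 2) {u : 𝓢'(Rn n, ℂ)}
    (hu : IsLp p u) :
    lpNorm (p / (p - 1)) (fourier n u) ^ 2 ≤ fourierConst n p * lpNorm p u ^ 2 := by
  rw [fourierConst, ← mul_pow]
  gcongr
  by_cases h0 : lpNorm p u = 0
  · rw [h0, mul_zero, ← h0]
    exact (hu.fourier hp1 hp2).2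
  · rw [← ENNReal.div_le_iff_le_mul (Or.inl h0) (Or.inl hu.lpNorm_ne_top)]
    refine le_sInf fun C hC => ?_
    rw [ENNReal.div_le_iff_le_mul (Or.inl h0) (Or.inl hu.lpNorm_ne_top)]
    exact hC u hu

theorem exists_schwartzMap_ne_zero : ∃ φ : 𝓢(Rn n, ℂ), φ ≠ 0 := by
  let b : ContDiffBump (0 : Rn n) := ⟨1, 2, one_pos, one_lt_two⟩
  have hc : HasCompactSupport (fun x => (b x : ℂ)) :=
    b.hasCompactSupport.comp_left (g := Complex.ofReal) rfl
  have hs : ContDiff ℝ (↑(⊤ : ℕ∞)) (fun x => (b x : ℂ)) := Complex.ofRealCLM.contDiff.comp b.contDiff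
  refine ⟨hc.toSchwartzMap hs, fun h => ?_⟩
  have h0 : (b 0 : ℂ) = 0 := by simpa using congrArg (fun φ : 𝓢(Rn n, ℂ) => φ 0) h
  have h1 : b 0 = 1 := b.one_of_mem_closedBall (by simp [b])
  simp [h1] at h0

theorem lpNorm_fourier_toLp_ne_zero {p q : ℝ≥0∞} [Fact (1 ≤ p)] [hq : Fact (1 ≤ q)]
    {φ : 𝓢(Rn n, ℂ)} (hφ : φ ≠ 0) :
    lpNorm q (fourier n (Lp.toTemperedDistribution (φ.toLp p))) ≠ 0 := by
  intro h
  rw [fourier_toTemperedDistribution_toLp (q := q), lpNorm_toTemperedDistribution,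
    enorm_eq_zero] at h
  have h0 : schwartzFourier n φ = 0 := by
    apply SchwartzMap.injective_toLp q volume
    exact h.trans (map_zero (SchwartzMap.toLpCLM ℂ ℂ q volume)).symm
  apply hφ
  rw [← schwartzFourierInv_schwartzFourier φ, h0, map_zero]

/-- A zero constant would annihilate the transform of a nonzero Schwartz function. Nonvanishing is
what makes `c_{n,p} · ∞ = ∞` in the final estimate. -/
theorem fourierConst_ne_zero {p : ℝ≥0∞} (hp1 : 1 ≤ p) (hp2 : p ≤ 2) : fourierConst n p ≠ 0 := by
  intro hC
  have hpt : p ≠ ∞ := (hp2.trans_lt (by simp)).ne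
  obtain ⟨q, hq⟩ : ∃ q, q = p / (p - 1) := ⟨_, rfl⟩
  have hpq := holderConjugate_div_sub_one hp1 hpt
  rw [← hq] at hpq
  have : Fact (1 ≤ p) := ⟨hp1⟩
  have : Fact (1 ≤ q) := ⟨by rw [hpq.conj_eq]; exact le_self_add⟩
  obtain ⟨φ, hφ⟩ := exists_schwartzMap_ne_zero (n := n)
  have h := lpNorm_fourier_sq_le hp1 hp2 (isLp_toTemperedDistribution (φ.toLp p))
  rw [hC, zero_mul, nonpos_iff_eq_zero, pow_eq_zero_iff two_ne_zero, ← hq] at h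
  exact lpNorm_fourier_toLp_ne_zero hφ h

variable {s : ℝ}

/-! ### Fourier transforms of elements of `H^s` -/

theorem isRepresentedBy_hat {u : 𝓢'(Rn n, ℂ)} {v : Rn n → ℂ}
    (h : IsRepresentedBy (fourier n u) v) : IsRepresentedBy (fourier n u) (hat u) := by
  have h' : ∃ v, IsRepresentedBy (fourier n u) v := ⟨v, h⟩
  rw [hat, dif_pos h']
  exact h'.choose_spec

/-- `Hs` is defined through `𝓕⁻¹(⟨·⟩^s û)`; Hausdorff–Young at `p = 2` moves the condition to the
Fourier side. -/
theorem Hs.isLp_bracketMul_fourier (f : Hs n s) : IsLp 2 (bracketMul n s (fourier n f.1)) := by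
  have hf : IsLp 2 (fourierInv n (bracketMul n s (fourier n f.1))) := f.2
  have h := (hf.fourier one_le_two le_rfl).1
  rw [fourier_fourierInv] at h
  have e : (2 : ℝ≥0∞) / (2 - 1) = 2 := by
    have : (2 : ℝ≥0∞) - 1 = 1 := by
      rw [← one_add_one_eq_two]
      exact ENNReal.add_sub_cancel_right (by simp)
    rw [this, div_one]
  rwa [e] at h

/-- Multiplying by `⟨·⟩^{-s}` shows that `f̂` is a function, so the default branch of `hat` is never
reached on `H^s`. -/
theorem Hs.isRepresentedBy_hat (f : Hs n s) : IsRepresentedBy (fourier n f.1) (hat f.1) := by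
  obtain ⟨w, hw, -⟩ := Hs.isLp_bracketMul_fourier f
  have h := hw.bracketMul (-s)
  rw [bracketMul_bracketMul, neg_add_cancel, bracketMul_zero] at h
  exact FourierPhase.isRepresentedBy_hat h

/-- The function `⟨·⟩^s û`. -/
noncomputable def bracketHat (s : ℝ) (u : 𝓢'(Rn n, ℂ)) (ξ : Rn n) : ℂ :=
  ((bracket ξ ^ s : ℝ) : ℂ) * hat u ξ

theorem Hs.isRepresentedBy_bracketHat (f : Hs n s) (t : ℝ) :
    IsRepresentedBy (bracketMul n t (fourier n f.1)) (bracketHat t f.1) :=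
  (Hs.isRepresentedBy_hat f).bracketMul t

theorem Hs.aestronglyMeasurable_bracketHat (f : Hs n s) (t : ℝ) :
    AEStronglyMeasurable (bracketHat t f.1) volume :=
  (Hs.isRepresentedBy_bracketHat f t).aestronglyMeasurable

theorem Hs.sobolevNorm_eq (f : Hs n s) :
    sobolevNorm s f.1 = eLpNorm (bracketHat s f.1) 2 volume :=
  (Hs.isRepresentedBy_bracketHat f s).lpNorm_eq 2

theorem Hs.memLp_bracketHat (f : Hs n s) : MemLp (bracketHat s f.1) 2 volume := by
  obtain ⟨w, hw, hw2⟩ := Hs.isLp_bracketMul_fourier f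
  exact hw2.ae_eq (hw.ae_eq (Hs.isRepresentedBy_bracketHat f s))

theorem Hs.hat_sub (f g : Hs n s) :
    hat (f - g : Hs n s).1 =ᵐ[volume] fun ξ => hat f.1 ξ - hat g.1 ξ := by
  have h := (Hs.isRepresentedBy_hat f).add ((Hs.isRepresentedBy_hat g).smul (-1))
  have e : fourier n (f - g : Hs n s).1 = fourier n f.1 + (-1 : ℂ) • fourier n g.1 := by
    rw [Submodule.coe_sub, map_sub]
    ext φ
    change fourier n f.1 φ - fourier n g.1 φ = fourier n f.1 φ + (-1 : ℂ) * fourier n g.1 φ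
    ring
  rw [← e] at h
  filter_upwards [(Hs.isRepresentedBy_hat (f - g)).ae_eq h] with ξ hξ
  rw [hξ]
  simp only [Pi.add_apply, Pi.smul_apply, smul_eq_mul]
  ring

theorem Hs.hat_eq_zero_of_notMem_dsupport (f : Hs n s) :
    ∀ᵐ ξ : Rn n, ξ ∉ dsupport (fourier n f.1) → hat f.1 ξ = 0 :=
  (Hs.isRepresentedBy_hat f).ae_eq_zero_of_notMem_dsupport

theorem Hs.eLpNorm_bracketHat_sq_le {p : ℝ≥0∞} (hp1 : 1 ≤ p) (hp2 : p ≤ 2) (f : Hs n s) (t : ℝ)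
    (h : besselNorm t p f.1 ≠ ∞) :
    eLpNorm (bracketHat t f.1) (p / (p - 1)) volume ^ 2 ≤
      fourierConst n p * besselNorm t p f.1 ^ 2 := by
  have h1 := lpNorm_fourier_sq_le hp1 hp2 (isLp_of_lpNorm_ne_top h)
  rwa [fourier_fourierInv, (Hs.isRepresentedBy_bracketHat f t).lpNorm_eq] at h1

/-! ### The estimate for a single pair of group elements -/

theorem eLpNorm_two_sq {E : Type*} [NormedAddCommGroup E] (F : Rn n → E) :
    eLpNorm F 2 volume ^ 2 = ∫⁻ ξ, ‖F ξ‖ₑ ^ 2 := by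
  rw [eLpNorm_eq_lintegral_rpow_enorm_toReal (by simp) (by simp), ← ENNReal.rpow_natCast,
    ← ENNReal.rpow_mul]
  simp

theorem measurableSet_suppInter (f g : 𝓢'(Rn n, ℂ)) : MeasurableSet (suppInter f g) :=
  ((isClosed_dsupport _).inter (isClosed_dsupport _)).measurableSet

/-- `(2-p)/p + 2(p-1)/p = 1`, including the endpoint pairs `(1, ∞)` for `p = 1` and `(∞, 1)` for `p
= 2`. -/
theorem holderTriple_weight {p : ℝ≥0∞} (hp1 : 1 ≤ p) (hp2 : p ≤ 2) :
    (p / (2 - p)).HolderTriple (p / (p - 1) / 2) 1 := by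
  have hpt : p ≠ ∞ := (hp2.trans_lt (by simp)).ne
  have hp0 : p ≠ 0 := (one_pos.trans_le hp1).ne'
  refine ⟨?_⟩
  have h1 : (p / (2 - p))⁻¹ = (2 - p) / p := ENNReal.inv_div (Or.inr hpt) (Or.inr hp0)
  have h2 : (p / (p - 1))⁻¹ = (p - 1) / p := ENNReal.inv_div (Or.inr hpt) (Or.inr hp0)
  have h3 : (p / (p - 1) / 2)⁻¹ = 2 * (p - 1) / p := by
    rw [ENNReal.inv_div (by simp) (by simp), div_eq_mul_inv, h2, mul_div_assoc]
  rw [h1, h3, ENNReal.div_add_div_same, inv_one]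
  have : 2 - p + 2 * (p - 1) = p := by
    lift p to NNReal using hpt
    norm_cast at hp1 hp2 ⊢
    ext
    push_cast [NNReal.coe_sub hp2, NNReal.coe_sub hp1]
    ring
  rw [this, ENNReal.div_self hp0 hpt]

theorem norm_sub_eq_of_eq_zero {a b : ℂ} (h : a = 0 ∨ b = 0) :
    ‖a - b‖ = ‖(‖a‖ - ‖b‖ : ℝ)‖ := by
  rcases h with rfl | rfl <;> simp

/-- The estimate for functions on the Fourier side. -/
theorem lintegral_sq_bracket_mul_le {p : ℝ≥0∞} (hp1 : 1 ≤ p) (hp2 : p ≤ 2) (s t : ℝ)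
    {A : Set (Rn n)} (hA : MeasurableSet A) {a b α β : Rn n → ℂ}
    (ha : ∀ᵐ ξ, ‖α ξ‖ = ‖a ξ‖) (hb : ∀ᵐ ξ, ‖β ξ‖ = ‖b ξ‖)
    (hA0 : ∀ᵐ ξ, ξ ∉ A → α ξ = 0 ∨ β ξ = 0)
    (hm : AEStronglyMeasurable (fun ξ => ((bracket ξ ^ t : ℝ) : ℂ) * (a ξ - b ξ)) volume) :
    ∫⁻ ξ, ‖((bracket ξ ^ s : ℝ) : ℂ) * (a ξ - b ξ)‖ₑ ^ 2 ≤
      eLpNorm (fun ξ : Rn n => bracket ξ ^ s * (‖α ξ‖ - ‖β ξ‖)) 2 volume ^ 2 +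
      weightConst A s t p *
        eLpNorm (fun ξ => ((bracket ξ ^ t : ℝ) : ℂ) * (a ξ - b ξ)) (p / (p - 1)) volume ^ 2 := by
  set h : Rn n → ℂ := fun ξ => ((bracket ξ ^ t : ℝ) : ℂ) * (a ξ - b ξ)
  set w : Rn n → ℝ := A.indicator fun ξ => bracket ξ ^ (2 * s - 2 * t)
  have hw : AEStronglyMeasurable w volume :=
    ((continuous_bracket_rpow _).measurable.indicator hA).aestronglyMeasurable
  have hh : AEStronglyMeasurable (fun ξ => ‖h ξ‖ ^ (2 : ℝ)) volume :=
    (hm.norm.aemeasurable.pow_const 2).aestronglyMeasurable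
  have hHolder : eLpNorm (w • fun ξ => ‖h ξ‖ ^ (2 : ℝ)) 1 volume ≤
      weightConst A s t p * eLpNorm h (p / (p - 1)) volume ^ 2 := by
    have := holderTriple_weight hp1 hp2
    refine (eLpNorm_smul_le_mul_eLpNorm (p := p / (2 - p)) (q := p / (p - 1) / 2) hh hw).trans
      (le_of_eq ?_)
    rw [eLpNorm_norm_rpow _ two_pos, ENNReal.ofReal_ofNat,
      ENNReal.div_mul_cancel (by simp) (by simp), weightConst]
    norm_cast
  refine le_trans ?_ (add_le_add le_rfl hHolder)
  rw [eLpNorm_two_sq, eLpNorm_one_eq_lintegral_enorm, ← lintegral_add_right' _ (hw.smul hh).enorm]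
  refine lintegral_mono_ae ?_
  filter_upwards [ha, hb, hA0] with ξ haξ hbξ hAξ
  have hpos := bracket_pos ξ
  by_cases hξ : ξ ∈ A
  -- On `A` the integrand equals `w |h|^2`.
  · refine le_trans (le_of_eq ?_) le_add_self
    rw [Pi.smul_apply', smul_eq_mul, ← ofReal_norm, ← ofReal_norm,
      ← ENNReal.ofReal_pow (norm_nonneg _)]
    congr 1
    simp only [w, Set.indicator_of_mem hξ, h, norm_mul, Complex.norm_real]
    rw [Real.norm_of_nonneg (by positivity), Real.norm_of_nonneg (by positivity),
      Real.norm_of_nonneg (by positivity), Real.norm_of_nonneg (by positivity), Real.rpow_two,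
      mul_pow, mul_pow, ← mul_assoc]
    congr 1
    rw [← Real.rpow_natCast, ← Real.rpow_natCast, ← Real.rpow_mul hpos.le,
      ← Real.rpow_mul hpos.le, ← Real.rpow_add hpos]
    congr 1
    push_cast
    ring
  -- Off `A` one of `a`, `b` vanishes, so the integrand depends only on the moduli.
  · refine le_trans (le_of_eq ?_) le_self_add
    have h0 : a ξ = 0 ∨ b ξ = 0 := by
      rcases hAξ hξ with h0 | h0
      · left
        rw [← norm_eq_zero, ← haξ, h0, norm_zero]
      · right
        rw [← norm_eq_zero, ← hbξ, h0, norm_zero]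
    rw [haξ, hbξ, ← ofReal_norm, ← ofReal_norm, norm_mul, norm_mul, Complex.norm_real,
      norm_sub_eq_of_eq_zero h0]


/-! ### Finiteness of the weight constant -/

/-- Serves both (i) and (ii): a bounded function on a set of finite measure is in every `L^q`. -/
theorem weightConst_lt_top_of_bound {A : Set (Rn n)} (hA : MeasurableSet A) (hv : volume A < ∞)
    (s t : ℝ) (p : ℝ≥0∞) {C : ℝ} (hC : ∀ ξ ∈ A, ‖bracket ξ ^ (2 * s - 2 * t)‖ ≤ C) :
    weightConst A s t p < ∞ := by
  have hfinite : IsFiniteMeasure (volume.restrict A) := ⟨by simpa using hv⟩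
  rw [weightConst, eLpNorm_indicator_eq_eLpNorm_restrict hA]
  exact (MemLp.of_bound (continuous_bracket_rpow _).aestronglyMeasurable C
    ((ae_restrict_iff' hA).2 (Filter.Eventually.of_forall hC))).2

theorem norm_bracket_rpow_le_one {r : ℝ} (hr : r ≤ 0) (ξ : Rn n) : ‖bracket ξ ^ r‖ ≤ 1 := by
  rw [Real.norm_of_nonneg (Real.rpow_nonneg (bracket_pos ξ).le _)]
  exact Real.rpow_le_one_of_one_le_of_nonpos (one_le_bracket ξ) hr

theorem weightConst_lt_top_of_lt {p : ℝ≥0∞} (hp1 : 1 ≤ p) (hp2 : p ≤ 2) {A : Set (Rn n)}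
    {s t : ℝ} (h : s < t - n * (1 / p.toReal - 1 / 2)) : weightConst A s t p < ∞ := by
  refine (eLpNorm_indicator_le _).trans_lt ?_
  have hpt : p ≠ ∞ := (hp2.trans_lt (by simp)).ne
  have hr1 : 1 ≤ p.toReal := by simpa using ENNReal.toReal_mono hpt hp1
  rcases hp2.eq_or_lt with rfl | hlt
  · have hst : 2 * s - 2 * t ≤ 0 := by
      simp only [ENNReal.toReal_ofNat, sub_self, mul_zero, sub_zero] at h
      linarith
    rw [tsub_self, ENNReal.div_zero (by simp), eLpNorm_exponent_top]
    exact (eLpNormEssSup_le_of_ae_bound (Filter.Eventually.of_forall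
      (norm_bracket_rpow_le_one hst))).trans_lt ENNReal.ofReal_lt_top
  · have hr2 : p.toReal < 2 := by simpa using (ENNReal.toReal_lt_toReal hpt (by simp)).2 hlt
    have hsub0 : 2 - p ≠ 0 := by simpa [tsub_eq_zero_iff_le] using hlt
    have hr : (p / (2 - p)).toReal = p.toReal / (2 - p.toReal) := by
      rw [ENNReal.toReal_div, ENNReal.toReal_sub_of_le hp2 (by simp), ENNReal.toReal_ofNat]
    have hr0 : p / (2 - p) ≠ 0 := by
      simp only [ne_eq, ENNReal.div_eq_zero_iff, not_or]
      exact ⟨(one_pos.trans_le hp1).ne', ENNReal.sub_ne_top (by simp)⟩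
    have hrt : p / (2 - p) ≠ ∞ := ENNReal.div_ne_top hpt hsub0
    have hmem : MemLp (fun ξ : Rn n => bracket ξ ^ (2 * s - 2 * t)) (p / (2 - p)) volume := by
      rw [← integrable_norm_rpow_iff (continuous_bracket_rpow _).aestronglyMeasurable hr0 hrt, hr]
      set r := p.toReal / (2 - p.toReal)
      have hrpos : 0 < r := div_pos (by linarith) (by linarith)
      have hexp : (Module.finrank ℝ (Rn n) : ℝ) < (2 * t - 2 * s) * r := by
        rw [finrank_euclideanSpace, Fintype.card_fin]
        -- With `r = p/(2-p)` one has `2(1/p - 1/2) r = 1`, so (iii) is exactly the integrability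
        -- condition `n < (2t-2s) r`.
        have e : (n : ℝ) = 2 * (n * (1 / p.toReal - 1 / 2)) * r := by
          have : p.toReal ≠ 0 := by linarith
          have : 2 - p.toReal ≠ 0 := by linarith
          simp only [r]
          field_simp
        rw [e]
        exact mul_lt_mul_of_pos_right (by linarith) hrpos
      refine (integrable_rpow_neg_one_add_norm_sq hexp).congr (Filter.Eventually.of_forall ?_)
      intro ξ
      simp only
      rw [Real.norm_of_nonneg (Real.rpow_nonneg (bracket_pos ξ).le _),
        ← Real.rpow_mul (bracket_pos ξ).le, bracket_rpow]
      congr 1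
      ring
    exact hmem.2

/-! ### The quotient distance -/

/-- Additivity gives `P(f - P⁻¹Qg) = Pf - Qg`, and `P` preserves the `H^s` norm because it preserves
`|f̂|`. -/
theorem quotDist_le_eLpNorm {G : Subgroup (Equiv.Perm (Hs n s))} (hG : G ≤ phaseGroup n s)
    (f g : Hs n s) {P Q : Equiv.Perm (Hs n s)} (hP : P ∈ G) (hQ : Q ∈ G) :
    quotDist G f g ≤ eLpNorm (bracketHat s (P f - Q g : Hs n s).1) 2 volume := by
  refine (iInf₂_le (P⁻¹ * Q) (G.mul_mem (G.inv_mem hP) hQ)).trans (le_of_eq ?_)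
  rw [Hs.sobolevNorm_eq]
  obtain ⟨hadd, habs⟩ := hG hP
  have e : P (f - (P⁻¹ * Q) g) = P f - Q g := by
    have h1 := hadd (f - (P⁻¹ * Q) g) ((P⁻¹ * Q) g)
    rw [sub_add_cancel] at h1
    have h2 : P ((P⁻¹ * Q) g) = Q g := by simp
    rw [h1, h2, add_sub_cancel_right]
  refine eLpNorm_congr_norm_ae ?_
  filter_upwards [habs (f - (P⁻¹ * Q) g)] with ξ hξ
  rw [e] at hξ
  rw [bracketHat, bracketHat, norm_mul, norm_mul, hξ]

theorem quotDist_sq_le {p : ℝ≥0∞} (hp1 : 1 ≤ p) (hp2 : p ≤ 2) (t : ℝ)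
    {G : Subgroup (Equiv.Perm (Hs n s))} (hG : G ≤ phaseGroup n s)
    (f g : Hs n s) {P Q : Equiv.Perm (Hs n s)} (hP : P ∈ G) (hQ : Q ∈ G) :
    quotDist G f g ^ 2 ≤
      eLpNorm (fun ξ : Rn n => bracket ξ ^ s * (‖hat f.1 ξ‖ - ‖hat g.1 ξ‖)) 2 volume ^ 2 +
      weightConst (suppInter f.1 g.1) s t p *
        eLpNorm (bracketHat t (P f - Q g : Hs n s).1) (p / (p - 1)) volume ^ 2 := by
  have hsub := Hs.hat_sub (P f) (Q g)
  have e : ∀ r : ℝ, bracketHat r (P f - Q g : Hs n s).1 =ᵐ[volume] fun ξ =>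
      ((bracket ξ ^ r : ℝ) : ℂ) * (hat (P f).1 ξ - hat (Q g).1 ξ) := by
    intro r
    filter_upwards [hsub] with ξ hξ
    rw [bracketHat, hξ]
  have h1 : quotDist G f g ^ 2 ≤
      eLpNorm (bracketHat s (P f - Q g : Hs n s).1) 2 volume ^ 2 := by
    gcongr
    exact quotDist_le_eLpNorm hG f g hP hQ
  refine h1.trans ?_
  rw [eLpNorm_congr_ae (e s), eLpNorm_congr_ae (e t), eLpNorm_two_sq]
  refine lintegral_sq_bracket_mul_le hp1 hp2 s t (measurableSet_suppInter _ _)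
    ((hG hP).2 f) ((hG hQ).2 g) ?_
    ((Hs.aestronglyMeasurable_bracketHat (P f - Q g) t).congr (e t))
  filter_upwards [Hs.hat_eq_zero_of_notMem_dsupport f, Hs.hat_eq_zero_of_notMem_dsupport g]
    with ξ hf hg hξ
  rw [suppInter, Set.mem_inter_iff, not_and_or] at hξ
  exact hξ.imp hf hg

theorem bracketHat_eq (s t : ℝ) (u : 𝓢'(Rn n, ℂ)) (ξ : Rn n) :
    bracketHat s u ξ = ((bracket ξ ^ (s - t) : ℝ) : ℂ) * bracketHat t u ξ := by
  rw [bracketHat, bracketHat, ← mul_assoc, ← Complex.ofReal_mul, ← Real.rpow_add (bracket_pos ξ),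
    sub_add_cancel]

/-- If the distances of representatives get arbitrarily small in a weighted `L^q` norm on the
Fourier side, then the quotient distance vanishes. -/
theorem quotDist_eq_zero_of_tendsto {t : ℝ} {q : ℝ≥0∞} (hq : q ≠ 0)
    {G : Subgroup (Equiv.Perm (Hs n s))} (hG : G ≤ phaseGroup n s) (f g : Hs n s)
    {P Q : ℕ → Equiv.Perm (Hs n s)} (hP : ∀ k, P k ∈ G) (hQ : ∀ k, Q k ∈ G)
    (hlim : Filter.Tendsto
      (fun k => eLpNorm (bracketHat t (P k f - Q k g : Hs n s).1) q volume)
      Filter.atTop (nhds 0)) :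
    quotDist G f g = 0 := by
  -- `L^q` convergence gives convergence in measure, hence almost everywhere along a subsequence.
  have hmeas := tendstoInMeasure_of_tendsto_eLpNorm hq (g := 0) (f := fun k =>
    bracketHat t (P k f - Q k g : Hs n s).1)
    (fun k => Hs.aestronglyMeasurable_bracketHat (P k f - Q k g) t)
    aestronglyMeasurable_zero (by simpa using hlim)
  obtain ⟨ns, -, hns⟩ := hmeas.exists_seq_tendsto_ae
  -- A majorant independent of `P k` and `Q k`, since these preserve moduli.
  set b : Rn n → ℝ := fun ξ => ‖bracketHat s f.1 ξ‖ + ‖bracketHat s g.1 ξ‖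
  have hb : MemLp b 2 volume := (Hs.memLp_bracketHat f).norm.add (Hs.memLp_bracketHat g).norm
  have hdom : Filter.Tendsto (fun i => ∫⁻ ξ,
      ‖bracketHat s (P (ns i) f - Q (ns i) g : Hs n s).1 ξ‖ₑ ^ 2) Filter.atTop
      (nhds (∫⁻ _ : Rn n, 0)) := by
    refine tendsto_lintegral_of_dominated_convergence' (fun ξ => ‖b ξ‖ₑ ^ 2)
      (fun i => ((Hs.aestronglyMeasurable_bracketHat _ s).enorm.pow_const 2)) (fun i => ?_) ?_ ?_
    · filter_upwards [Hs.hat_sub (P (ns i) f) (Q (ns i) g), (hG (hP (ns i))).2 f,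
        (hG (hQ (ns i))).2 g] with ξ h1 h2 h3
      gcongr
      rw [enorm_le_iff_norm_le, Real.norm_of_nonneg (by positivity), bracketHat, h1]
      simp only [b, bracketHat, norm_mul, h2, h3, ← mul_add]
      gcongr
      exact norm_sub_le _ _
    · rw [← eLpNorm_two_sq]
      exact ENNReal.pow_ne_top hb.2.ne
    · filter_upwards [hns] with ξ hξ
      have h1 := ENNReal.Tendsto.pow (n := 2)
        (hξ.const_mul ((bracket ξ ^ (s - t) : ℝ) : ℂ)).enorm
      simpa [← bracketHat_eq] using h1
  have h0 : quotDist G f g ^ 2 ≤ 0 := by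
    rw [lintegral_zero] at hdom
    refine ge_of_tendsto' hdom fun i => ?_
    rw [← eLpNorm_two_sq]
    gcongr
    exact quotDist_le_eLpNorm hG f g (hP _) (hQ _)
  simpa using h0

/-- Handles the product `∞ · 0`: Hausdorff–Young sends a minimizing sequence to zero in the weighted
`L^{p'}` norm. -/
theorem quotDist_eq_zero_of_iInf_eq_zero {p : ℝ≥0∞} (hp1 : 1 ≤ p) (hp2 : p ≤ 2) (t : ℝ)
    {G : Subgroup (Equiv.Perm (Hs n s))} (hG : G ≤ phaseGroup n s) (f g : Hs n s)
    (h : (⨅ P ∈ G, ⨅ Q ∈ G, besselNorm t p (P f - Q g : Hs n s).1 ^ 2) = 0) :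
    quotDist G f g = 0 := by
  have hex : ∀ k : ℕ, ∃ P ∈ G, ∃ Q ∈ G,
      besselNorm t p (P f - Q g : Hs n s).1 ^ 2 < ((k : ℝ≥0∞) + 1)⁻¹ := by
    intro k
    have hk : (⨅ P ∈ G, ⨅ Q ∈ G, besselNorm t p (P f - Q g : Hs n s).1 ^ 2)
        < ((k : ℝ≥0∞) + 1)⁻¹ := by
      rw [h]
      simp
    simpa only [iInf_lt_iff, exists_prop] using hk
  choose P hP Q hQ hPQ using hex
  have hq : p / (p - 1) ≠ 0 := by
    have hpt : p ≠ ∞ := (hp2.trans_lt (by simp)).ne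
    simp only [ne_eq, ENNReal.div_eq_zero_iff, not_or]
    exact ⟨(one_pos.trans_le hp1).ne', ENNReal.sub_ne_top hpt⟩
  refine quotDist_eq_zero_of_tendsto (t := t) hq hG f g hP hQ ?_
  have hle : ∀ k, eLpNorm (bracketHat t (P k f - Q k g : Hs n s).1) (p / (p - 1)) volume ^ 2 ≤
      ((k : ℝ≥0∞) + 1)⁻¹ := by
    intro k
    have hne : besselNorm t p (P k f - Q k g : Hs n s).1 ≠ ∞ := by
      intro htop
      have := hPQ k
      rw [htop] at this
      simp at this
    refine (Hs.eLpNorm_bracketHat_sq_le hp1 hp2 _ t hne).trans ?_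
    exact (mul_le_of_le_one_left' (fourierConst_le_one hp1 hp2)).trans (hPQ k).le
  have hsq : Filter.Tendsto (fun k =>
      eLpNorm (bracketHat t (P k f - Q k g : Hs n s).1) (p / (p - 1)) volume ^ 2)
      Filter.atTop (nhds 0) := by
    refine tendsto_of_tendsto_of_tendsto_of_le_of_le tendsto_const_nhds ?_ (fun _ => zero_le) hle
    have := (Filter.tendsto_add_atTop_iff_nat 1).2 ENNReal.tendsto_inv_nat_nhds_zero
    simpa using this
  have := hsq.ennrpow_const (1 / 2)
  refine (this.congr fun k => ?_).trans (by simp)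
  rw [← ENNReal.rpow_natCast, ← ENNReal.rpow_mul]
  simp

end FourierPhase

/-! ### Passing to the infimum over the group -/

theorem theorem1 (n : ℕ) (hn : 0 < n) (t s : ℝ) (p : ℝ≥0∞) (hp1 : 1 ≤ p) (hp2 : p ≤ 2)
    (G : Subgroup (Equiv.Perm (Hs n s))) (hG : G ≤ phaseGroup n s) (f g : Hs n s) :
    quotDist G f g ^ 2 ≤
        eLpNorm (fun ξ : Rn n => bracket ξ ^ s * (‖hat f.1 ξ‖ - ‖hat g.1 ξ‖)) 2 volume ^ 2
        + fourierConst n p * weightConst (suppInter f.1 g.1) s t p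
          * (⨅ P ∈ G, ⨅ Q ∈ G, besselNorm t p (P f - Q g : Hs n s).1 ^ 2)
      ∧ fourierConst n p ≤ 1
      ∧ (IsCompact (suppInter f.1 g.1) → weightConst (suppInter f.1 g.1) s t p < ∞)
      ∧ (volume (suppInter f.1 g.1) < ∞ → s ≤ t →
          weightConst (suppInter f.1 g.1) s t p < ∞)
      ∧ (s < t - n * (1 / p.toReal - 1 / 2) →
          weightConst (suppInter f.1 g.1) s t p < ∞) := by
  have hc1 := fourierConst_le_one (n := n) hp1 hp2
  have hc0 := fourierConst_ne_zero (n := n) hp1 hp2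
  refine ⟨?_, hc1, fun hA => ?_, fun hA hst => ?_, weightConst_lt_top_of_lt hp1 hp2⟩
  -- With zero weight the product vanishes even if every Bessel norm is infinite, so the identity
  -- pair is enough.
  · by_cases hW0 : weightConst (suppInter f.1 g.1) s t p = 0
    · have h := quotDist_sq_le hp1 hp2 t hG f g G.one_mem G.one_mem
      rw [hW0, zero_mul] at h
      rw [hW0, mul_zero, zero_mul]
      exact h
    by_cases hWt : weightConst (suppInter f.1 g.1) s t p = ∞
    -- With infinite weight the right-hand side is infinite unless the infimum is zero.
    · by_cases hI : (⨅ P ∈ G, ⨅ Q ∈ G, besselNorm t p (P f - Q g : Hs n s).1 ^ 2) = 0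
      · rw [quotDist_eq_zero_of_iInf_eq_zero hp1 hp2 t hG f g hI]
        simp
      · rw [hWt, ENNReal.mul_top hc0, ENNReal.top_mul hI, add_top]
        exact le_top
    · have hcW0 : fourierConst n p * weightConst (suppInter f.1 g.1) s t p ≠ 0 :=
        mul_ne_zero hc0 hW0
      have hcWt : fourierConst n p * weightConst (suppInter f.1 g.1) s t p ≠ ∞ :=
        ENNReal.mul_ne_top (hc1.trans_lt ENNReal.one_lt_top).ne hWt
      -- A nonzero finite factor commutes with the infimum, leaving one estimate for each pair `P,
      -- Q`.
      simp only [ENNReal.mul_iInf_of_ne hcW0 hcWt, ENNReal.add_iInf]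
      refine le_iInf₂ fun P hP => le_iInf₂ fun Q hQ => ?_
      by_cases hB : besselNorm t p (P f - Q g : Hs n s).1 = ∞
      · rw [hB, ENNReal.top_pow two_ne_zero, ENNReal.mul_top hcW0, add_top]
        exact le_top
      · refine (quotDist_sq_le hp1 hp2 t hG f g hP hQ).trans ?_
        rw [mul_comm (fourierConst n p), mul_assoc]
        gcongr
        exact Hs.eLpNorm_bracketHat_sq_le hp1 hp2 _ t hB
  · obtain ⟨C, hC⟩ := hA.exists_bound_of_continuousOn
      (continuous_bracket_rpow (2 * s - 2 * t)).continuousOn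
    exact weightConst_lt_top_of_bound (measurableSet_suppInter _ _) hA.measure_lt_top s t p hC
  · exact weightConst_lt_top_of_bound (measurableSet_suppInter _ _) hA s t p
      fun ξ _ => norm_bracket_rpow_le_one (by linarith) ξ
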